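/- Let $\Omega\subset\mathbb{R}^2$ be a bounded open set and let $\omega\colon\overline\Omega\to\mathbb{R}$ be Lipschitz continuous. Let $H^1_0(\Omega)$ be the closure of $C_c^\infty(\Omega)$ in the $H^1$ norm, $H^{-1}(\Omega)$ its dual, and let $\mathcal{J}(\omega)\colon H^1_0(\Omega)\to H^{-1}(\Omega)$ be the bounded linear operator $$(\mathcal{J}(\omega)\psi,\phi)=\int_\Omega \omega\,\{\psi,\phi\}\,dx\quad(\phi\in H^1_0(\Omega)),\qquad \{a,b\}=\partial_y a\,\partial_x b-\partial_x a\,\partial_y b .$$ Let $g$ be the set-valued function on $\mathbb{R}$ $$g(\xi)=g_L(\xi)+\sum_{\ell=1}^{\nu}\alpha_\ell Y(\xi-\omega_\ell),$$ where $g_L\colon\mathbb{R}\to\mathbb{R}$ is Lipschitz continuous, $\alpha_\ell\in\mathbb{R}$, each $\omega_\ell$ is the height of a plateau of $\omega$ (that is, $\omega=\omega_\ell$ on some non-empty open subset of $\Omega$), and $Y$ is the filled step function: $Y(t)=\{0\}$ for $t<0$, $Y(0)=[0,1]$, $Y(t)=\{1\}$ for $t>0$. Assume $0\in g(\omega(x))$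 for all $x\in\partial\Omega$. Let $G\colon\mathbb{R}\to\mathbb{R}$ be a locally Lipschitz function with $\tilde\partial G(\xi)=g(\xi)$ for all $\xi$, where the Clarke gradient $\tilde\partial G(\xi)$ is the convex hull of all limits $\lim_j G'(\xi+\delta_j)$ with $\delta_j\to0$. Then $C_G(u)=\int_\Omega G(u)\,dx$ is a generalized (singular) Casimir element, in the following sense. 1. $G(u)$ is integrable for every $u\in L^2(\Omega)$ and $C_G$ is locally Lipschitz on $L^2(\Omega)$. Hence its Clarke generalized gradient $\tilde\partial C_G(\omega)=\{\psi\in L^2(\Omega):(\psi,v)\le C_G^\circ(\omega;v)\ \forall v\in L^2(\Omega)\}$ is defined, where $C_G^\circ(\omega;v)=\limsup_{u\to\omega,\;t\downarrow0}\,[C_G(u+tv)-C_G(u)]/t$. 2. $\tilde\partial C_G(\omega)=\{\psi\in L^2(\Omega):\psi(x)\in g(\omega(x))\text{ for a.e. }x\in\Omega\}$, and this set is not empty. 3. Every element of $\tilde\partial C_G(\omega)$ that belongs to the domain $H^1_0(\Omega)$ of $\mathcal{J}(\omega)$ lies in $\operatorname{Ker}\mathcal{J}(\omega)$. 4. Suppose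 that for each $\ell$ with $\alpha_\ell\ne0$ the sets $\{x\in\Omega:\omega(x)<\omega_\ell\}$ and $\{x\in\Omega:\omega(x)>\omega_\ell\}$ have disjoint closures and every $x\in\partial\Omega$ with $\omega(x)=\omega_\ell$ has a neighbourhood $V$ with $\omega=\omega_\ell$ on $V\cap\Omega$ (no condition if there is no jump). Then $\tilde\partial C_G(\omega)\cap\operatorname{Ker}\mathcal{J}(\omega)\ne\emptyset$. -/

import Mathlib

open MeasureTheory Set Filter Topology
open scoped ENNReal NNReal

noncomputable section

/-- The Euclidean plane. -/
abbrev Plane : Type := EuclideanSpace ℝ (Fin 2)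

/-- The Hilbert space `L²(Ω)` of real functions. -/
abbrev L2 (Ω : Set Plane) : Type := Lp ℝ 2 (volume.restrict Ω)

/-- The Hilbert space `L²(Ω; ℝ²)` of vector fields. -/
abbrev L2Vec (Ω : Set Plane) : Type := Lp Plane 2 (volume.restrict Ω)

/-- Test functions: smooth, with compact support contained in `Ω`. -/
def IsTestFunction (Ω : Set Plane) (φ : Plane → ℝ) : Prop :=
  ContDiff ℝ ((⊤ : ℕ∞) : WithTop ℕ∞) φ ∧ HasCompactSupport φ ∧ tsupport φ ⊆ Ω

lemma gradient_add_smul {φ χ : Plane → ℝ} (hφ : ContDiff ℝ ((⊤ : ℕ∞) : WithTop ℕ∞) φ) (hχ : ContDiff ℝ ((⊤ : ℕ∞) : WithTop ℕ∞) χ)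
    (c : ℝ) (x : Plane) :
    gradient (fun y => φ y + c * χ y) x = gradient φ x + c • gradient χ x := by
  have h1 : DifferentiableAt ℝ φ x := hφ.differentiable (by simp) x
  have h2 : DifferentiableAt ℝ χ x := hχ.differentiable (by simp) x
  have h3 := h1.hasFDerivAt.add (h2.hasFDerivAt.const_mul c)
  have h4 : fderiv ℝ (fun y => φ y + c * χ y) x = fderiv ℝ φ x + c • fderiv ℝ χ x := h3.fderiv
  simp [gradient, h4]

lemma IsTestFunction.add_mul {Ω : Set Plane} {φ χ : Plane → ℝ} (hφ : IsTestFunction Ω φ)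
    (hχ : IsTestFunction Ω χ) (c : ℝ) : IsTestFunction Ω (fun y => φ y + c * χ y) := by
  obtain ⟨a1, a2, a3⟩ := hφ
  obtain ⟨b1, b2, b3⟩ := hχ
  refine ⟨a1.add (contDiff_const.mul b1), a2.add (b2.mul_left (f := fun _ => c)), ?_⟩
  refine (tsupport_add φ (fun y => c * χ y)).trans (union_subset a3 ?_)
  exact (tsupport_mul_subset_right (f := fun _ => c) (g := χ)).trans b3

/-- The pairs `(φ, ∇φ)`, with `φ` a test function, as a subspace of `L²(Ω) × L²(Ω; ℝ²)` with the
`H¹` norm `(‖φ‖² + ‖∇φ‖²)^{1/2}`. -/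
def testGraph (Ω : Set Plane) : Submodule ℝ (WithLp 2 (L2 Ω × L2Vec Ω)) where
  carrier := {w | ∃ φ : Plane → ℝ, IsTestFunction Ω φ ∧
    (w.fst =ᵐ[volume.restrict Ω] φ) ∧ (w.snd =ᵐ[volume.restrict Ω] gradient φ)}
  zero_mem' := by
    refine ⟨fun _ => 0, ⟨contDiff_const, HasCompactSupport.zero, by simp [tsupport]⟩, ?_, ?_⟩
    · exact Lp.coeFn_zero ℝ 2 (volume.restrict Ω)
    · have h : gradient (fun _ : Plane => (0 : ℝ)) = fun _ => 0 := by
        ext1 x; simp [gradient]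
      rw [h]
      exact Lp.coeFn_zero Plane 2 (volume.restrict Ω)
  add_mem' := by
    rintro v w ⟨φ, hφ, h1, h2⟩ ⟨χ, hχ, h3, h4⟩
    refine ⟨fun y => φ y + 1 * χ y, hφ.add_mul hχ 1, ?_, ?_⟩
    · filter_upwards [Lp.coeFn_add v.fst w.fst, h1, h3] with x e a b
      refine e.trans ?_
      simp [a, b]
    · filter_upwards [Lp.coeFn_add v.snd w.snd, h2, h4] with x e a b
      rw [gradient_add_smul hφ.1 hχ.1]
      refine e.trans ?_
      simp [a, b]
  smul_mem' := by
    rintro c w ⟨χ, hχ, h3, h4⟩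
    have h0 : IsTestFunction Ω (fun _ => 0) :=
      ⟨contDiff_const, HasCompactSupport.zero, by simp [tsupport]⟩
    refine ⟨fun y => 0 + c * χ y, h0.add_mul hχ c, ?_, ?_⟩
    · filter_upwards [Lp.coeFn_smul c w.fst, h3] with x e b
      simp [e, b]
    · filter_upwards [Lp.coeFn_smul c w.snd, h4] with x e b
      have hz : gradient (fun _ : Plane => (0 : ℝ)) x = 0 := by simp [gradient]
      rw [gradient_add_smul h0.1 hχ.1, hz]
      simp [e, b]

/-- The Sobolev space `H¹₀(Ω)`, the closure of the test functions in the `H¹` norm. Its elements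
are the pairs `(ψ, ∇ψ)` of an `H¹₀` function and its weak gradient. -/
abbrev H10 (Ω : Set Plane) : Submodule ℝ (WithLp 2 (L2 Ω × L2Vec Ω)) :=
  (testGraph Ω).topologicalClosure

/-- The underlying `L²` function of an element of `H¹₀(Ω)`. -/
def h10ToL2 {Ω : Set Plane} (ψ : H10 Ω) : L2 Ω := (ψ : WithLp 2 (L2 Ω × L2Vec Ω)).fst

/-- The weak gradient of an element of `H¹₀(Ω)`. -/
def h10Grad {Ω : Set Plane} (ψ : H10 Ω) : L2Vec Ω := (ψ : WithLp 2 (L2 Ω × L2Vec Ω)).snd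

/-- The dual space `H⁻¹(Ω)` of `H¹₀(Ω)`. -/
abbrev HMinus1 (Ω : Set Plane) : Type := StrongDual ℝ (H10 Ω)

/-- The bracket `{a, b} = ∂_y a ∂_x b - ∂_x a ∂_y b` in terms of `p = ∇a` and `q = ∇b`. -/
def bracket (p q : Plane) : ℝ := p 1 * q 0 - p 0 * q 1

lemma abs_bracket_le (p q : Plane) : |bracket p q| ≤ ‖p‖ * ‖q‖ := by
  refine abs_le_of_sq_le_sq ?_ (by positivity)
  rw [mul_pow, EuclideanSpace.norm_sq_eq, EuclideanSpace.norm_sq_eq]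
  simp only [Fin.sum_univ_two, Real.norm_eq_abs, sq_abs, bracket]
  nlinarith [sq_nonneg (p 0 * q 0 + p 1 * q 1)]

lemma integrable_norm_mul_norm {Ω : Set Plane} (p q : L2Vec Ω) :
    Integrable (fun x => ‖p x‖ * ‖q x‖) (volume.restrict Ω) :=
  MemLp.integrable_mul (Lp.memLp p).norm (Lp.memLp q).norm

lemma integral_norm_mul_norm_le {Ω : Set Plane} (p q : L2Vec Ω) :
    ∫ x in Ω, ‖p x‖ * ‖q x‖ ≤ ‖p‖ * ‖q‖ := by
  have hp := (Lp.memLp p).norm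
  have hq := (Lp.memLp q).norm
  have h := real_inner_le_norm (hp.toLp _) (hq.toLp _)
  rw [L2.inner_def] at h
  have e : ∫ x in Ω, inner ℝ ((hp.toLp _ : L2 Ω) x) ((hq.toLp _ : L2 Ω) x)
      = ∫ x in Ω, ‖p x‖ * ‖q x‖ := by
    refine integral_congr_ae ?_
    filter_upwards [hp.coeFn_toLp, hq.coeFn_toLp] with x a b
    rw [a, b]; simp [mul_comm]
  rw [e] at h
  rw [Lp.norm_toLp, Lp.norm_toLp, eLpNorm_norm, eLpNorm_norm] at h
  simpa only [Lp.norm_def] using h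

lemma integrable_mul_bracket {Ω : Set Plane} {ω : Plane → ℝ}
    (hω : MemLp ω ∞ (volume.restrict Ω)) (p q : L2Vec Ω) :
    Integrable (fun x => ω x * bracket (p x) (q x)) (volume.restrict Ω) := by
  have hb : Integrable (fun x => bracket (p x) (q x)) (volume.restrict Ω) := by
    refine (integrable_norm_mul_norm p q).mono' ?_ (.of_forall fun x => abs_bracket_le _ _)
    have hc : Continuous (fun z : Plane × Plane => bracket z.1 z.2) := by
      unfold bracket; fun_prop
    exact hc.comp_aestronglyMeasurable
      ((Lp.aestronglyMeasurable p).prodMk (Lp.aestronglyMeasurable q))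
  exact hb.mul_of_top_right hω

lemma integral_mul_bracket_add_left {Ω : Set Plane} {ω : Plane → ℝ}
    (hω : MemLp ω ∞ (volume.restrict Ω)) (p p' q : L2Vec Ω) :
    ∫ x in Ω, ω x * bracket ((p + p') x) (q x) =
      (∫ x in Ω, ω x * bracket (p x) (q x)) + ∫ x in Ω, ω x * bracket (p' x) (q x) := by
  rw [← integral_add (integrable_mul_bracket hω _ _) (integrable_mul_bracket hω _ _)]
  refine integral_congr_ae ?_
  filter_upwards [Lp.coeFn_add p p'] with x e
  simp only [e, bracket, Pi.add_apply, PiLp.add_apply]; ring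

lemma integral_mul_bracket_smul_left {Ω : Set Plane} {ω : Plane → ℝ} (c : ℝ) (p q : L2Vec Ω) :
    ∫ x in Ω, ω x * bracket ((c • p) x) (q x) = c • ∫ x in Ω, ω x * bracket (p x) (q x) := by
  rw [← integral_smul]
  refine integral_congr_ae ?_
  filter_upwards [Lp.coeFn_smul c p] with x e
  simp only [e, bracket, Pi.smul_apply, PiLp.smul_apply, smul_eq_mul]; ring

lemma integral_mul_bracket_add_right {Ω : Set Plane} {ω : Plane → ℝ}
    (hω : MemLp ω ∞ (volume.restrict Ω)) (p q q' : L2Vec Ω) :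
    ∫ x in Ω, ω x * bracket (p x) ((q + q') x) =
      (∫ x in Ω, ω x * bracket (p x) (q x)) + ∫ x in Ω, ω x * bracket (p x) (q' x) := by
  rw [← integral_add (integrable_mul_bracket hω _ _) (integrable_mul_bracket hω _ _)]
  refine integral_congr_ae ?_
  filter_upwards [Lp.coeFn_add q q'] with x e
  simp only [e, bracket, Pi.add_apply, PiLp.add_apply]; ring

lemma integral_mul_bracket_smul_right {Ω : Set Plane} {ω : Plane → ℝ} (c : ℝ) (p q : L2Vec Ω) :
    ∫ x in Ω, ω x * bracket (p x) ((c • q) x) = c • ∫ x in Ω, ω x * bracket (p x) (q x) := by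
  rw [← integral_smul]
  refine integral_congr_ae ?_
  filter_upwards [Lp.coeFn_smul c q] with x e
  simp only [e, bracket, Pi.smul_apply, PiLp.smul_apply, smul_eq_mul]; ring

lemma norm_integral_mul_bracket_le {Ω : Set Plane} {ω : Plane → ℝ}
    (hω : MemLp ω ∞ (volume.restrict Ω)) (p q : L2Vec Ω) :
    ‖∫ x in Ω, ω x * bracket (p x) (q x)‖ ≤
      (eLpNorm ω ∞ (volume.restrict Ω)).toReal * (‖p‖ * ‖q‖) := by
  have hM : ∀ᵐ x ∂(volume.restrict Ω), ‖ω x‖ ≤ (eLpNorm ω ∞ (volume.restrict Ω)).toReal := by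
    filter_upwards [ae_le_eLpNormEssSup (f := ω) (μ := volume.restrict Ω)] with x hx
    rw [← eLpNorm_exponent_top] at hx
    have h := ENNReal.toReal_mono hω.eLpNorm_ne_top hx
    rw [toReal_enorm] at h
    exact h
  have h1 : ‖∫ x in Ω, ω x * bracket (p x) (q x)‖ ≤
      ∫ x in Ω, (eLpNorm ω ∞ (volume.restrict Ω)).toReal * (‖p x‖ * ‖q x‖) := by
    refine norm_integral_le_of_norm_le ((integrable_norm_mul_norm p q).const_mul _) ?_
    filter_upwards [hM] with x hx
    rw [norm_mul]
    exact mul_le_mul hx (abs_bracket_le _ _) (norm_nonneg _) ENNReal.toReal_nonneg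
  rw [integral_const_mul] at h1
  exact h1.trans (mul_le_mul_of_nonneg_left (integral_norm_mul_norm_le _ _)
    ENNReal.toReal_nonneg)

/-- The form `(ψ, φ) ↦ (ω, {ψ, φ}) = ∫_Ω ω {ψ, φ} dx` on `H¹₀(Ω)`. -/
def poissonForm {Ω : Set Plane} {ω : Plane → ℝ} (hω : MemLp ω ∞ (volume.restrict Ω)) :
    H10 Ω →ₗ[ℝ] H10 Ω →ₗ[ℝ] ℝ :=
  LinearMap.mk₂ ℝ (fun ψ φ : H10 Ω => ∫ x in Ω, ω x * bracket (h10Grad ψ x) (h10Grad φ x))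
    (fun a b c => integral_mul_bracket_add_left hω (h10Grad a) (h10Grad b) (h10Grad c))
    (fun c a b => integral_mul_bracket_smul_left c (h10Grad a) (h10Grad b))
    (fun a b c => integral_mul_bracket_add_right hω (h10Grad a) (h10Grad b) (h10Grad c))
    (fun c a b => integral_mul_bracket_smul_right c (h10Grad a) (h10Grad b))

lemma norm_poissonForm_le {Ω : Set Plane} {ω : Plane → ℝ}
    (hω : MemLp ω ∞ (volume.restrict Ω)) (ψ φ : H10 Ω) :
    ‖poissonForm hω ψ φ‖ ≤ (eLpNorm ω ∞ (volume.restrict Ω)).toReal * ‖ψ‖ * ‖φ‖ := by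
  have h1 : ‖h10Grad ψ‖ ≤ ‖ψ‖ :=
    WithLp.norm_snd_le _ (ψ : WithLp 2 (L2 Ω × L2Vec Ω))
  have h2 : ‖h10Grad φ‖ ≤ ‖φ‖ :=
    WithLp.norm_snd_le _ (φ : WithLp 2 (L2 Ω × L2Vec Ω))
  rw [mul_assoc]
  exact (norm_integral_mul_bracket_le hω (h10Grad ψ) (h10Grad φ)).trans
    (mul_le_mul_of_nonneg_left (mul_le_mul h1 h2 (norm_nonneg _) (norm_nonneg _))
      ENNReal.toReal_nonneg)

/-- The noncanonical Poisson operator `𝒥(ω) : H¹₀(Ω) → H⁻¹(Ω)`, a bounded linear map, defined by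
`(𝒥(ω)ψ, φ) = (ω, {ψ, φ})` for all `φ ∈ H¹₀(Ω)`. -/
def poissonOperator {Ω : Set Plane} {ω : Plane → ℝ} (hω : MemLp ω ∞ (volume.restrict Ω)) :
    H10 Ω →L[ℝ] HMinus1 Ω :=
  (poissonForm hω).mkContinuous₂ (eLpNorm ω ∞ (volume.restrict Ω)).toReal
    (norm_poissonForm_le hω)

lemma poissonOperator_apply {Ω : Set Plane} {ω : Plane → ℝ}
    (hω : MemLp ω ∞ (volume.restrict Ω)) (ψ φ : H10 Ω) :
    poissonOperator hω ψ φ = ∫ x in Ω, ω x * bracket (h10Grad ψ x) (h10Grad φ x) := rfl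

/-- A Lipschitz function on the closure of a bounded open set belongs to every `L^p`. -/
lemma memLp_of_lipschitzOn_closure {Ω : Set Plane} (hΩ : IsOpen Ω) (hb : Bornology.IsBounded Ω)
    {K : ℝ≥0} {ω : Plane → ℝ} (hω : LipschitzOnWith K ω (closure Ω)) (p : ℝ≥0∞) :
    MemLp ω p (volume.restrict Ω) := by
  have hc : IsCompact (closure Ω) := hb.isCompact_closure
  obtain ⟨C, hC⟩ := hc.exists_bound_of_continuousOn hω.continuousOn
  have : IsFiniteMeasure (volume.restrict Ω) :=
    ⟨by rw [Measure.restrict_apply_univ]; exact hb.measure_lt_top⟩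
  refine MemLp.of_bound
    ((hω.continuousOn.mono subset_closure).aestronglyMeasurable hΩ.measurableSet) C ?_
  filter_upwards [ae_restrict_mem hΩ.measurableSet] with x hx
  exact hC x (subset_closure hx)

/-- The Clarke gradient of a locally Lipschitz function of one real variable: the convex hull of
the limits of derivatives at nearby points of differentiability. -/
def clarkeGradientReal (F : ℝ → ℝ) (x : ℝ) : Set ℝ :=
  convexHull ℝ {d | ∃ δ : ℕ → ℝ, Tendsto δ atTop (𝓝 0) ∧
    (∀ j, DifferentiableAt ℝ F (x + δ j)) ∧
    Tendsto (fun j => deriv F (x + δ j)) atTop (𝓝 d)}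

/-- Clarke's generalized directional derivative
`f°(u; v) = limsup_{y → u, t ↓ 0} (f (y + t v) - f y) / t`. -/
def clarkeDirDeriv {X : Type*} [NormedAddCommGroup X] [InnerProductSpace ℝ X]
    (f : X → ℝ) (u v : X) : EReal :=
  limsup (fun p : X × ℝ => (((f (p.1 + p.2 • v) - f p.1) / p.2 : ℝ) : EReal))
    (𝓝 u ×ˢ 𝓝[>] (0 : ℝ))

/-- The Clarke generalized gradient of a locally Lipschitz functional on a Hilbert space. -/
def clarkeGradient {X : Type*} [NormedAddCommGroup X] [InnerProductSpace ℝ X]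
    (f : X → ℝ) (u : X) : Set X :=
  {ξ | ∀ v : X, ((inner ℝ ξ v : ℝ) : EReal) ≤ clarkeDirDeriv f u v}

/-- The filled Heaviside step function. -/
def filledStep (t : ℝ) : Set ℝ :=
  {s | (t < 0 → s = 0) ∧ (t = 0 → s ∈ Icc (0 : ℝ) 1) ∧ (0 < t → s = 1)}

/-- The set-valued function `g(ξ) = g_L(ξ) + ∑_ℓ α_ℓ Y(ξ - h_ℓ)` with filled steps `Y`. -/
def jumpFunction (gL : ℝ → ℝ) {ν : ℕ} (α h : Fin ν → ℝ) (ξ : ℝ) : Set ℝ :=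
  {y | ∃ s : Fin ν → ℝ, (∀ l, s l ∈ filledStep (ξ - h l)) ∧ y = gL ξ + ∑ l, α l * s l}

/-- `c` is the height of a plateau of `ω`: `ω = c` on a nonempty open subset of `Ω`. -/
def IsPlateauHeight (Ω : Set Plane) (ω : Plane → ℝ) (c : ℝ) : Prop :=
  ∃ U : Set Plane, IsOpen U ∧ U.Nonempty ∧ U ⊆ Ω ∧ ∀ x ∈ U, ω x = c

/-- The level set at height `c` fills a gap: the regions where `ω` is below and above `c` have no
common limit point, and near each boundary point at height `c`, `ω` is equal to `c`. -/
def IsSeparatingHeight (Ω : Set Plane) (ω : Plane → ℝ) (c : ℝ) : Prop :=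
  Disjoint (closure {x ∈ Ω | ω x < c}) (closure {x ∈ Ω | c < ω x}) ∧
    ∀ x ∈ frontier Ω, ω x = c → ∀ᶠ y in 𝓝[Ω] x, ω y = c

/-- The functional `C_G(u) = ∫_Ω G(u) dx` on `L²(Ω)`. -/
def casimir (Ω : Set Plane) (G : ℝ → ℝ) (u : L2 Ω) : ℝ := ∫ x in Ω, G (u x)

end

/-!
The hypothesis on the Clarke gradient determines `G` explicitly: away from the finitely many jump
heights the derivative of `G` is prescribed, and `G` is absolutely continuous, so `G` is a constant
plus `jumpPrimitive`, the sum of a primitive of `gL` and of one ramp for each step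
(`exists_eq_const_add_jumpPrimitive`). Hence `G` has quadratic growth with a matching local
Lipschitz bound, which gives the integrability of `G(u)` and the local Lipschitz continuity of the
Casimir functional.

*Clarke gradient.* Testing an element `ψ` of the gradient with the directions `±1_A`, and bounding
the difference quotients of `G` by the values of `g` near `ω(x)` with an error linear in
`|u(x) - ω(x)|`, yields upper and lower bounds for `∫_A ψ` on every measurable set `A`, hence
`ψ ∈ g ∘ ω` almost everywhere (`ae_mem_of_mem_clarkeGradient`). Conversely, for a selection `ψ` and
a direction `v`, base points `ω + √t σ` with a suitable sign `σ(x) = ±1` turn the difference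
quotients into the one-sided derivative of `G` at `ω(x)` that is favourable to `v(x)`; since `ψ(x)`
lies between the two one-sided derivatives, `(ψ, v)` is at most the generalized directional
derivative (`mem_clarkeGradient_of_ae_mem`).

*Kernel.* For a test function `φ` an integration by parts gives `(𝒥(ω)ψ, φ) = -∫ ψ {ω, φ}`, because
the second derivatives of `φ` cancel. If `ψ` is a selection of `g ∘ ω`, then `ψ ∇ω = ∇(G ∘ ω)` almost
everywhere: away from the jump heights this is the chain rule, and on the level sets at these
heights `∇ω = 0`. So the integral is `∫ {G ∘ ω, φ} = 0` (`mem_ker_poissonOperator`).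

*Existence.* Under the separation hypothesis each step of `g ∘ ω` can be replaced by a Lipschitz
function that interpolates across the level set, with boundary values that balance to `0` because
`0 ∈ g ∘ ω` on the boundary (`exists_h10_selection`). The resulting Lipschitz selection vanishes on
the boundary, and such functions belong to `H¹₀(Ω)`: truncations followed by mollification are
bounded in `H¹`, and balls of a Hilbert space are weakly compact (`exists_h10_of_lipschitz`).
-/

open MeasureTheory Set Filter Topology
open scoped ENNReal NNReal

noncomputable section

/-! ### Primitives of jump functions -/

/-- The right-continuous selection of `jumpFunction`: each step has the value `1` at its jump. -/
def jumpRight (gL : ℝ → ℝ) {ν : ℕ} (α h : Fin ν → ℝ) (ξ : ℝ) : ℝ :=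
  gL ξ + ∑ l, α l * (if h l ≤ ξ then 1 else 0)

/-- The left-continuous selection of `jumpFunction`: each step has the value `0` at its jump. -/
def jumpLeft (gL : ℝ → ℝ) {ν : ℕ} (α h : Fin ν → ℝ) (ξ : ℝ) : ℝ :=
  gL ξ + ∑ l, α l * (if h l < ξ then 1 else 0)

/-- The primitive of `jumpFunction` that integrates each step to a ramp. -/
def jumpPrimitive (gL : ℝ → ℝ) {ν : ℕ} (α h : Fin ν → ℝ) (ξ : ℝ) : ℝ :=
  (∫ t in (0 : ℝ)..ξ, gL t) + ∑ l, α l * max (ξ - h l) 0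

lemma jumpLeft_mem (gL : ℝ → ℝ) {ν : ℕ} (α h : Fin ν → ℝ) (ξ : ℝ) :
    jumpLeft gL α h ξ ∈ jumpFunction gL α h ξ := by
  refine ⟨fun l => if h l < ξ then 1 else 0, fun l => ⟨fun a => ?_, fun a => ?_, fun a => ?_⟩, rfl⟩
  · exact if_neg (by linarith)
  · dsimp only
    split_ifs <;> simp
  · exact if_pos (by linarith)

lemma hasDerivWithinAt_ramp_Ici (c ξ : ℝ) :
    HasDerivWithinAt (fun x : ℝ => max (x - c) 0) (if c ≤ ξ then 1 else 0) (Ici ξ) ξ := by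
  split_ifs with hc
  · refine ((hasDerivAt_id ξ).sub_const c).hasDerivWithinAt.congr (fun x hx => ?_) ?_
    · exact max_eq_left (by linarith [mem_Ici.1 hx])
    · exact max_eq_left (by linarith)
  · have : (fun x : ℝ => max (x - c) 0) =ᶠ[𝓝 ξ] fun _ => 0 := by
      filter_upwards [Iio_mem_nhds (not_le.1 hc)] with x hx
      exact max_eq_right (by linarith [mem_Iio.1 hx])
    exact ((hasDerivAt_const ξ (0 : ℝ)).congr_of_eventuallyEq this).hasDerivWithinAt

lemma hasDerivWithinAt_ramp_Iic (c ξ : ℝ) :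
    HasDerivWithinAt (fun x : ℝ => max (x - c) 0) (if c < ξ then 1 else 0) (Iic ξ) ξ := by
  split_ifs with hc
  · have : (fun x : ℝ => max (x - c) 0) =ᶠ[𝓝 ξ] fun x => x - c := by
      filter_upwards [Ioi_mem_nhds hc] with x hx
      exact max_eq_left (by linarith [mem_Ioi.1 hx])
    exact (((hasDerivAt_id ξ).sub_const c).congr_of_eventuallyEq this).hasDerivWithinAt
  · refine (hasDerivAt_const ξ (0 : ℝ)).hasDerivWithinAt.congr (fun x hx => ?_) ?_
    · exact max_eq_right (by linarith [mem_Iic.1 hx])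
    · exact max_eq_right (by linarith)

variable {gL : ℝ → ℝ} {ν : ℕ} {α h : Fin ν → ℝ}

lemma hasDerivAt_integral_of_continuous (hc : Continuous gL) (ξ : ℝ) :
    HasDerivAt (fun x => ∫ t in (0 : ℝ)..x, gL t) (gL ξ) ξ :=
  intervalIntegral.integral_hasDerivAt_right (hc.intervalIntegrable _ _)
    (hc.stronglyMeasurableAtFilter _ _) hc.continuousAt

lemma hasDerivWithinAt_jumpPrimitive_Ici (hc : Continuous gL) (ξ : ℝ) :
    HasDerivWithinAt (jumpPrimitive gL α h) (jumpRight gL α h ξ) (Ici ξ) ξ :=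
  (hasDerivAt_integral_of_continuous hc ξ).hasDerivWithinAt.add
    (HasDerivWithinAt.fun_sum fun l _ => (hasDerivWithinAt_ramp_Ici (h l) ξ).const_mul (α l))

lemma hasDerivWithinAt_jumpPrimitive_Iic (hc : Continuous gL) (ξ : ℝ) :
    HasDerivWithinAt (jumpPrimitive gL α h) (jumpLeft gL α h ξ) (Iic ξ) ξ :=
  (hasDerivAt_integral_of_continuous hc ξ).hasDerivWithinAt.add
    (HasDerivWithinAt.fun_sum fun l _ => (hasDerivWithinAt_ramp_Iic (h l) ξ).const_mul (α l))

lemma jumpRight_eq_jumpLeft {ξ : ℝ} (hξ : ∀ l, ξ ≠ h l) :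
    jumpRight gL α h ξ = jumpLeft gL α h ξ := by
  unfold jumpRight jumpLeft
  congr 1
  refine Finset.sum_congr rfl fun l _ => ?_
  simp only [(hξ l).symm.le_iff_lt]

lemma hasDerivAt_jumpPrimitive (hc : Continuous gL) {ξ : ℝ} (hξ : ∀ l, ξ ≠ h l) :
    HasDerivAt (jumpPrimitive gL α h) (jumpLeft gL α h ξ) ξ := by
  have h1 := hasDerivWithinAt_jumpPrimitive_Ici (α := α) (h := h) hc ξ
  rw [jumpRight_eq_jumpLeft hξ] at h1
  have := (hasDerivWithinAt_jumpPrimitive_Iic (α := α) (h := h) hc ξ).union h1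
  rwa [Iic_union_Ici, hasDerivWithinAt_univ] at this

lemma jumpFunction_eq_singleton {ξ : ℝ} (hξ : ∀ l, ξ ≠ h l) :
    jumpFunction gL α h ξ = {jumpLeft gL α h ξ} := by
  refine Subset.antisymm ?_ (singleton_subset_iff.2 (jumpLeft_mem _ _ _ _))
  rintro y ⟨s, hs, rfl⟩
  rw [mem_singleton_iff, jumpLeft]
  congr 1
  refine Finset.sum_congr rfl fun l _ => ?_
  congr 1
  rcases lt_or_gt_of_ne (hξ l) with hl | hl
  · rw [(hs l).1 (by linarith), if_neg (by linarith)]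
  · rw [(hs l).2.2 (by linarith), if_pos hl]

lemma locallyLipschitz_jumpPrimitive (hc : Continuous gL) :
    LocallyLipschitz (jumpPrimitive gL α h) := by
  have h1 : ContDiff ℝ 1 (fun x => ∫ t in (0 : ℝ)..x, gL t) := by
    rw [contDiff_one_iff_deriv]
    refine ⟨fun x => (hasDerivAt_integral_of_continuous hc x).differentiableAt, ?_⟩
    rwa [funext fun x => (hasDerivAt_integral_of_continuous hc x).deriv]
  have h2 : LipschitzWith (∑ l, ‖α l‖₊) (fun ξ : ℝ => ∑ l, α l * max (ξ - h l) 0) := by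
    refine LipschitzWith.of_dist_le_mul fun x y => ?_
    rw [Real.dist_eq, ← Finset.sum_sub_distrib]
    refine (Finset.abs_sum_le_sum_abs _ _).trans ?_
    push_cast
    rw [Finset.sum_mul]
    refine Finset.sum_le_sum fun l _ => ?_
    rw [← mul_sub, abs_mul, Real.dist_eq]
    refine mul_le_mul_of_nonneg_left ?_ (abs_nonneg _)
    have := abs_max_sub_max_le_abs (x - h l) (y - h l) 0
    simpa using this
  intro x
  obtain ⟨K1, t1, ht1, hK1⟩ := h1.locallyLipschitz x
  exact ⟨K1 + ∑ l, ‖α l‖₊, t1, ht1, hK1.add (h2.lipschitzOnWith (s := t1))⟩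

lemma deriv_mem_clarkeGradientReal {G : ℝ → ℝ} {ξ : ℝ} (hd : DifferentiableAt ℝ G ξ) :
    deriv G ξ ∈ clarkeGradientReal G ξ :=
  subset_convexHull ℝ _ ⟨fun _ => 0, tendsto_const_nhds, by simpa using hd, by simp⟩

/-- The Clarke gradient determines a locally Lipschitz function up to a constant: where
`jumpFunction` is single-valued the derivative of `G` is prescribed, the remaining points are
finitely many, and `G` is absolutely continuous. -/
theorem exists_eq_const_add_jumpPrimitive (hc : Continuous gL) {G : ℝ → ℝ}
    (hG : LocallyLipschitz G) (hg : ∀ ξ, jumpFunction gL α h ξ = clarkeGradientReal G ξ) :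
    ∃ c, ∀ ξ, G ξ = c + jumpPrimitive gL α h ξ := by
  have key : ∀ a b : ℝ, a ≤ b →
      G a - jumpPrimitive gL α h a = G b - jumpPrimitive gL α h b := by
    intro a b hab
    obtain ⟨K1, hK1⟩ := (hG.locallyLipschitzOn (s := uIcc a b)).exists_lipschitzOnWith_of_compact
      isCompact_uIcc
    obtain ⟨K2, hK2⟩ := ((locallyLipschitz_jumpPrimitive (α := α) (h := h)
      hc).locallyLipschitzOn (s := uIcc a b)).exists_lipschitzOnWith_of_compact isCompact_uIcc
    have hac := (hK1.sub hK2).absolutelyContinuousOnInterval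
    have hz : ∀ᵐ x, x ∈ uIcc a b →
        HasDerivAt (fun y => G y - jumpPrimitive gL α h y) 0 x := by
      have hfin : ∀ᵐ x : ℝ, x ∉ Set.range h :=
        measure_eq_zero_iff_ae_notMem.1 ((Set.finite_range h).measure_zero volume)
      have hab' : ∀ᵐ x : ℝ, x ∉ ({a, b} : Set ℝ) :=
        measure_eq_zero_iff_ae_notMem.1 ((Set.toFinite _).measure_zero volume)
      filter_upwards [hK1.ae_differentiableWithinAt_of_mem, hfin, hab'] with x hx hxh hxab hxm
      have hn : uIcc a b ∈ 𝓝 x := by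
        rw [uIcc_of_le hab] at hxm ⊢
        refine Icc_mem_nhds (lt_of_le_of_ne hxm.1 ?_) (lt_of_le_of_ne hxm.2 ?_)
        · rintro rfl; simp at hxab
        · rintro rfl; simp at hxab
      have hd : DifferentiableAt ℝ G x := (hx hxm).differentiableAt hn
      have hne : ∀ l, x ≠ h l := fun l e => hxh ⟨l, e.symm⟩
      have hv := deriv_mem_clarkeGradientReal hd
      rw [← hg, jumpFunction_eq_singleton hne, mem_singleton_iff] at hv
      have := hd.hasDerivAt.sub (hasDerivAt_jumpPrimitive (α := α) (h := h) hc hne)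
      rwa [hv, sub_self] at this
    obtain ⟨C, hC⟩ := hac.const_of_ae_hasDerivAt_zero hz
    exact (hC a left_mem_uIcc).trans (hC b right_mem_uIcc).symm
  refine ⟨G 0 - jumpPrimitive gL α h 0, fun ξ => ?_⟩
  rcases le_total 0 ξ with h0 | h0
  · linarith [key 0 ξ h0]
  · linarith [key ξ 0 h0]

/-- Near `ξ` the jump part of `jumpRight` takes only its two one-sided values at `ξ`. -/
lemma eventually_jumpRight_sub (ξ : ℝ) : ∀ᶠ η in 𝓝 ξ,
    jumpRight gL α h η - gL η + gL ξ ∈ ({jumpLeft gL α h ξ, jumpRight gL α h ξ} : Set ℝ) := by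
  have h1 : ∀ᶠ η in 𝓝 ξ, ∀ l, (h l < ξ → h l < η) ∧ (ξ < h l → η < h l) := by
    refine eventually_all.2 fun l => ?_
    refine Filter.Eventually.and ?_ ?_
    · by_cases hl : h l < ξ
      · filter_upwards [Ioi_mem_nhds hl] with η hη _ using hη
      · exact .of_forall fun η hη => absurd hη hl
    · by_cases hl : ξ < h l
      · filter_upwards [Iio_mem_nhds hl] with η hη _ using hη
      · exact .of_forall fun η hη => absurd hη hl
  filter_upwards [h1] with η hη
  rcases lt_or_ge η ξ with hlt | hge
  · left
    unfold jumpLeft jumpRight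
    have : ∀ l, (h l ≤ η) ↔ (h l < ξ) := fun l =>
      ⟨fun a => a.trans_lt hlt, fun a => ((hη l).1 a).le⟩
    simp only [this]; ring
  · right
    unfold jumpRight
    have : ∀ l, (h l ≤ η) ↔ (h l ≤ ξ) := fun l =>
      ⟨fun a => by by_contra hc; exact absurd ((hη l).2 (not_le.1 hc)) (not_lt.2 a),
        fun a => a.trans hge⟩
    simp only [this, mem_singleton_iff]; ring

/-- The values of the Clarke gradient lie between the two one-sided derivatives. For the jump
function this is what excludes cancelling jumps at the same height. -/
theorem clarkeGradientReal_subset_uIcc (hc : Continuous gL) {G : ℝ → ℝ} {c : ℝ}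
    (hG : ∀ ξ, G ξ = c + jumpPrimitive gL α h ξ) (ξ : ℝ) :
    clarkeGradientReal G ξ ⊆ uIcc (jumpLeft gL α h ξ) (jumpRight gL α h ξ) := by
  refine convexHull_min ?_ (convex_uIcc _ _)
  rintro d ⟨δ, hδ, hd, hlim⟩
  have hder : ∀ η, DifferentiableAt ℝ G η → deriv G η = jumpRight gL α h η := fun η hη => by
    have h1 : HasDerivWithinAt G (jumpRight gL α h η) (Ici η) η := by
      rw [show G = fun ξ => c + jumpPrimitive gL α h ξ from funext hG]
      exact (hasDerivWithinAt_jumpPrimitive_Ici hc η).const_add c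
    exact (uniqueDiffWithinAt_Ici η).eq_deriv _ hη.hasDerivAt.hasDerivWithinAt h1
  have hξ : Tendsto (fun j => ξ + δ j) atTop (𝓝 ξ) := by simpa using hδ.const_add ξ
  have h2 : Tendsto (fun j => deriv G (ξ + δ j) - gL (ξ + δ j) + gL ξ) atTop (𝓝 d) := by
    have := (hlim.sub ((hc.tendsto ξ).comp hξ)).add_const (gL ξ)
    simpa using this
  have hcl : IsClosed ({jumpLeft gL α h ξ, jumpRight gL α h ξ} : Set ℝ) :=
    (Set.toFinite _).isClosed
  have h3 := hcl.mem_of_tendsto h2 (by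
    filter_upwards [hξ.eventually (eventually_jumpRight_sub ξ)] with j hj
    rwa [hder _ (hd j)])
  rcases h3 with rfl | rfl
  · exact left_mem_uIcc
  · exact right_mem_uIcc

lemma abs_integral_sub_mul_le {L : ℝ≥0} (hgL : LipschitzWith L gL) (a b c : ℝ) :
    |(∫ t in (0 : ℝ)..b, gL t) - (∫ t in (0 : ℝ)..a, gL t) - gL c * (b - a)| ≤
      L * (|a - c| + |b - a|) * |b - a| := by
  have hc := hgL.continuous
  have e : (∫ t in (0 : ℝ)..b, gL t) - (∫ t in (0 : ℝ)..a, gL t) - gL c * (b - a)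
      = ∫ t in a..b, (gL t - gL c) := by
    rw [intervalIntegral.integral_interval_sub_left (hc.intervalIntegrable _ _)
      (hc.intervalIntegrable _ _), intervalIntegral.integral_sub (hc.intervalIntegrable _ _)
      (by simp)]
    simp [mul_comm]
  rw [e, ← Real.norm_eq_abs]
  refine intervalIntegral.norm_integral_le_of_norm_le_const fun t ht => ?_
  rw [← dist_eq_norm]
  refine (hgL.dist_le_mul t c).trans (mul_le_mul_of_nonneg_left ?_ L.2)
  have h1 : |t - a| ≤ |b - a| := abs_sub_left_of_mem_uIcc (uIoc_subset_uIcc ht)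
  calc dist t c ≤ |t - a| + |a - c| := abs_sub_le t a c
    _ ≤ _ := by linarith

/-- The primitive has at most quadratic growth, with the matching local Lipschitz bound. -/
lemma exists_abs_jumpPrimitive_sub_le {L : ℝ≥0} (hgL : LipschitzWith L gL) :
    ∃ C, 0 ≤ C ∧ ∀ a b : ℝ, |jumpPrimitive gL α h b - jumpPrimitive gL α h a| ≤
      C * (1 + |a| + |b|) * |b - a| := by
  refine ⟨|gL 0| + 2 * L + ∑ l, |α l|, by positivity, fun a b => ?_⟩
  have h1 := abs_integral_sub_mul_le hgL a b 0
  have h2 : |∑ l, α l * max (b - h l) 0 - ∑ l, α l * max (a - h l) 0| ≤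
      (∑ l, |α l|) * |b - a| := by
    rw [← Finset.sum_sub_distrib, Finset.sum_mul]
    refine (Finset.abs_sum_le_sum_abs _ _).trans (Finset.sum_le_sum fun l _ => ?_)
    rw [← mul_sub, abs_mul]
    refine mul_le_mul_of_nonneg_left ?_ (abs_nonneg _)
    simpa using abs_max_sub_max_le_abs (b - h l) (a - h l) 0
  have h3 : |jumpPrimitive gL α h b - jumpPrimitive gL α h a| ≤
      (L * (|a - 0| + |b - a|) * |b - a| + |gL 0| * |b - a|) + (∑ l, |α l|) * |b - a| := by
    unfold jumpPrimitive
    rw [add_sub_add_comm]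
    refine (abs_add_le _ _).trans (add_le_add ?_ h2)
    rw [← abs_mul]
    have := abs_add_le ((∫ t in (0 : ℝ)..b, gL t) - (∫ t in (0 : ℝ)..a, gL t) - gL 0 * (b - a))
      (gL 0 * (b - a))
    rw [sub_add_cancel] at this
    linarith
  refine h3.trans ?_
  have h4 : |b - a| ≤ |b| + |a| := abs_sub _ _
  rw [sub_zero, ← add_mul, ← add_mul]
  refine mul_le_mul_of_nonneg_right ?_ (abs_nonneg _)
  have hL : (0 : ℝ) ≤ L := L.2
  have hS : 0 ≤ ∑ l, |α l| := by positivity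
  nlinarith [abs_nonneg a, abs_nonneg b, abs_nonneg (gL 0), mul_nonneg hL (abs_nonneg a),
    mul_nonneg hL (abs_nonneg b), mul_nonneg hS (abs_nonneg a), mul_nonneg hS (abs_nonneg b),
    mul_nonneg (abs_nonneg (gL 0)) (abs_nonneg a), mul_nonneg (abs_nonneg (gL 0)) (abs_nonneg b),
    mul_le_mul_of_nonneg_left h4 hL]

/-! ### Difference quotients of the primitive -/

lemma exists_ramp_slope (c : ℝ) {a b : ℝ} (hab : a ≠ b) :
    ∃ θ ∈ Icc (0 : ℝ) 1, max (b - c) 0 - max (a - c) 0 = θ * (b - a) ∧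
      (a ≤ c → b ≤ c → θ = 0) ∧ (c ≤ a → c ≤ b → θ = 1) := by
  have hne : b - a ≠ 0 := sub_ne_zero.2 hab.symm
  refine ⟨(max (b - c) 0 - max (a - c) 0) / (b - a), ?_, (div_mul_cancel₀ _ hne).symm,
    fun h1 h2 => ?_, fun h1 h2 => ?_⟩
  · rcases lt_or_gt_of_ne hab with hl | hl
    · rw [mem_Icc, le_div_iff₀ (by linarith), div_le_iff₀ (by linarith)]
      constructor <;> rcases max_cases (b - c) 0 with ⟨e, _⟩ | ⟨e, _⟩ <;>
        rcases max_cases (a - c) 0 with ⟨e', _⟩ | ⟨e', _⟩ <;> rw [e, e'] <;> linarith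
    · rw [← neg_div_neg_eq, mem_Icc, le_div_iff₀ (by linarith), div_le_iff₀ (by linarith)]
      constructor <;> rcases max_cases (b - c) 0 with ⟨e, _⟩ | ⟨e, _⟩ <;>
        rcases max_cases (a - c) 0 with ⟨e', _⟩ | ⟨e', _⟩ <;> rw [e, e'] <;> linarith
  · rw [max_eq_right (by linarith), max_eq_right (by linarith)]; simp
  · rw [max_eq_left (by linarith), max_eq_left (by linarith)]
    rw [sub_sub_sub_cancel_right, div_self hne]

/-- An upper bound for `β` times the slopes of the ramp at `c` over subintervals of
`[ξ - δ, ξ + δ]`. -/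
def rampSlopeBound (β c δ ξ : ℝ) : ℝ :=
  max (β * (if c < ξ + δ then 1 else 0)) (β * (if c ≤ ξ - δ then 1 else 0))

lemma abs_rampSlopeBound_le (β c δ ξ : ℝ) : |rampSlopeBound β c δ ξ| ≤ |β| := by
  refine abs_max_le_max_abs_abs.trans (max_le ?_ ?_) <;> split_ifs <;> simp

lemma measurable_rampSlopeBound (β c δ : ℝ) : Measurable (rampSlopeBound β c δ) := by
  refine Measurable.max ?_ ?_
  · exact (Measurable.ite (measurableSet_lt measurable_const (by fun_prop)) measurable_const
      measurable_const).const_mul β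
  · exact (Measurable.ite (measurableSet_le measurable_const (by fun_prop)) measurable_const
      measurable_const).const_mul β

/-- The difference quotients of the primitive in the direction `s = ±1`, based at `u` and compared
with the values of the jump function near `ξ`. The error is linear in `|u - ξ|` also when `u` is
far from `ξ`, so that after integration it is controlled by the `L²` distance. -/
lemma jumpPrimitive_slope_le {L : ℝ≥0} (hgL : LipschitzWith L gL) {s t δ : ℝ} (hs : |s| = 1)
    (ht : 0 < t) (htδ : t ≤ δ / 2) (u ξ : ℝ) :
    (jumpPrimitive gL α h (u + t * s) - jumpPrimitive gL α h u) / t ≤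
      (s * gL ξ + ∑ l, rampSlopeBound (s * α l) (h l) δ ξ) + L * t +
        (L + (∑ l, |α l|) * (4 / δ)) * |u - ξ| := by
  have hδ : 0 < δ := by linarith
  have hss : s * s = 1 := by rw [← abs_mul_abs_self, hs, one_mul]
  have hts : |t * s| = t := by rw [abs_mul, hs, mul_one, abs_of_pos ht]
  have hne : u ≠ u + t * s := by
    intro e
    have : t * s = 0 := by linarith
    rw [this, abs_zero] at hts
    linarith
  have h1 := abs_integral_sub_mul_le hgL u (u + t * s) ξ
  rw [add_sub_cancel_left, hts] at h1
  have h2 : ∀ l, α l * max (u + t * s - h l) 0 - α l * max (u - h l) 0 ≤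
      (rampSlopeBound (s * α l) (h l) δ ξ + |α l| * (4 / δ) * |u - ξ|) * t := by
    intro l
    obtain ⟨θ, hθ, e, hθ0, hθ1⟩ := exists_ramp_slope (h l) hne
    rw [← mul_sub, e, add_sub_cancel_left, show α l * (θ * (t * s)) = (s * α l * θ) * t by ring]
    refine mul_le_mul_of_nonneg_right ?_ ht.le
    rcases le_or_gt |u - ξ| (δ / 2) with hu | hu
    · have hu' := abs_le.1 hu
      have hs' := abs_le.1 hts.le
      have : s * α l * θ ≤ rampSlopeBound (s * α l) (h l) δ ξ := by
        unfold rampSlopeBound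
        rcases le_total 0 (s * α l) with hb | hb
        · refine le_max_of_le_left (mul_le_mul_of_nonneg_left ?_ hb)
          split_ifs with hc
          · exact hθ.2
          · exact (hθ0 (by linarith) (by linarith)).le
        · refine le_max_of_le_right (mul_le_mul_of_nonpos_left ?_ hb)
          split_ifs with hc
          · exact (hθ1 (by linarith) (by linarith)).ge
          · exact hθ.1
      have h0 : 0 ≤ |α l| * (4 / δ) * |u - ξ| := by positivity
      linarith
    · have hb := neg_le_of_abs_le (abs_rampSlopeBound_le (s * α l) (h l) δ ξ)
      have hb2 : s * α l * θ ≤ |α l| := by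
        refine (le_abs_self _).trans ?_
        rw [abs_mul, abs_mul, hs, one_mul, abs_of_nonneg hθ.1]
        exact mul_le_of_le_one_right (abs_nonneg _) hθ.2
      rw [abs_mul, hs, one_mul] at hb
      have : 2 ≤ 4 / δ * |u - ξ| := by
        rw [div_mul_eq_mul_div, le_div_iff₀ hδ]; linarith
      have := mul_le_mul_of_nonneg_left this (abs_nonneg (α l))
      rw [← mul_assoc] at this
      linarith
  rw [div_le_iff₀ ht]
  have h3 : ∑ l, α l * max (u + t * s - h l) 0 - ∑ l, α l * max (u - h l) 0 ≤
      (∑ l, rampSlopeBound (s * α l) (h l) δ ξ + (∑ l, |α l|) * (4 / δ) * |u - ξ|) * t := by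
    rw [← Finset.sum_sub_distrib, Finset.sum_mul, Finset.sum_mul, ← Finset.sum_add_distrib,
      Finset.sum_mul]
    exact Finset.sum_le_sum fun l _ => h2 l
  have h4 := (abs_le.1 h1).2
  unfold jumpPrimitive
  rw [add_sub_add_comm]
  nlinarith

/-- As `δ → 0` the slope bounds become the value at `ξ` of a selection of the jump function. -/
lemma exists_mem_jumpFunction_rampSlopeBound (s ξ : ℝ) :
    ∃ y ∈ jumpFunction gL α h ξ, ∀ᶠ δ in 𝓝[>] (0 : ℝ),
      s * gL ξ + ∑ l, rampSlopeBound (s * α l) (h l) δ ξ = s * y := by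
  have key : ∀ l, ∃ r ∈ filledStep (ξ - h l), ∀ᶠ δ in 𝓝[>] (0 : ℝ),
      rampSlopeBound (s * α l) (h l) δ ξ = s * (α l * r) := by
    intro l
    rcases lt_trichotomy ξ (h l) with hl | hl | hl
    · refine ⟨0, ⟨fun _ => rfl, fun _ => by simp, fun a => by linarith⟩, ?_⟩
      filter_upwards [self_mem_nhdsWithin,
        mem_nhdsWithin_of_mem_nhds (Iio_mem_nhds (show (0 : ℝ) < h l - ξ by linarith))] with δ h0 h1
      rw [mem_Ioi] at h0
      rw [mem_Iio] at h1
      rw [rampSlopeBound, if_neg (by linarith), if_neg (by linarith)]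
      simp
    · rcases le_total 0 (s * α l) with hb | hb
      · refine ⟨1, ⟨fun a => by linarith, fun _ => by simp, fun _ => rfl⟩, ?_⟩
        filter_upwards [self_mem_nhdsWithin] with δ h0
        rw [mem_Ioi] at h0
        rw [rampSlopeBound, if_pos (by linarith), if_neg (by linarith)]
        simpa using hb
      · refine ⟨0, ⟨fun _ => rfl, fun _ => by simp, fun a => by linarith⟩, ?_⟩
        filter_upwards [self_mem_nhdsWithin] with δ h0
        rw [mem_Ioi] at h0
        rw [rampSlopeBound, if_pos (by linarith), if_neg (by linarith)]
        simpa using hb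
    · refine ⟨1, ⟨fun a => by linarith, fun _ => by simp, fun _ => rfl⟩, ?_⟩
      filter_upwards [self_mem_nhdsWithin,
        mem_nhdsWithin_of_mem_nhds (Iio_mem_nhds (show (0 : ℝ) < ξ - h l by linarith))] with δ h0 h1
      rw [mem_Ioi] at h0
      rw [mem_Iio] at h1
      rw [rampSlopeBound, if_pos (by linarith), if_pos (by linarith)]
      simp
  choose r hr hr' using key
  refine ⟨_, ⟨r, hr, rfl⟩, ?_⟩
  filter_upwards [eventually_all.2 hr'] with δ hδ
  rw [Finset.sum_congr rfl fun l _ => hδ l, ← Finset.mul_sum, mul_add]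

/-- Moving the base point by `±√t`, much more than the step `t v`, selects the one-sided
derivative. -/
lemma tendsto_ramp_slope (c ξ v : ℝ) {σ : ℝ} (hσ : σ = 1 ∨ σ = -1) :
    Tendsto (fun t : ℝ => (max (ξ + √t * σ + t * v - c) 0 - max (ξ + √t * σ - c) 0) / t)
      (𝓝[>] 0) (𝓝 ((if c < ξ ∨ (c = ξ ∧ σ = 1) then 1 else 0) * v)) := by
  have hsq : Tendsto (fun t : ℝ => √t) (𝓝[>] 0) (𝓝 0) := by
    have := (Real.continuous_sqrt.tendsto 0).mono_left (nhdsWithin_le_nhds (s := Ioi 0))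
    simpa using this
  have hid : Tendsto (fun t : ℝ => t) (𝓝[>] 0) (𝓝 0) := nhdsWithin_le_nhds
  have h1 : Tendsto (fun t : ℝ => ξ + √t * σ) (𝓝[>] 0) (𝓝 ξ) := by
    simpa using (hsq.mul_const σ).const_add ξ
  have h2 : Tendsto (fun t : ℝ => ξ + √t * σ + t * v) (𝓝[>] 0) (𝓝 ξ) := by
    simpa using h1.add (hid.mul_const v)
  have h3 : ∀ᶠ t in 𝓝[>] (0 : ℝ), |t * v| < √t := by
    have : Tendsto (fun t : ℝ => √t * |v|) (𝓝[>] 0) (𝓝 0) := by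
      simpa using hsq.mul_const |v|
    filter_upwards [this.eventually (Iio_mem_nhds one_pos), self_mem_nhdsWithin] with t a b
    have hp := Real.sqrt_pos.2 (mem_Ioi.1 b)
    rw [abs_mul, abs_of_pos (mem_Ioi.1 b)]
    calc t * |v| = √t * (√t * |v|) := by rw [← mul_assoc, Real.mul_self_sqrt (mem_Ioi.1 b).le]
      _ < √t * 1 := mul_lt_mul_of_pos_left a hp
      _ = √t := mul_one _
  have hup : (∀ᶠ t in 𝓝[>] (0 : ℝ), c ≤ ξ + √t * σ ∧ c ≤ ξ + √t * σ + t * v) →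
      Tendsto (fun t : ℝ => (max (ξ + √t * σ + t * v - c) 0 - max (ξ + √t * σ - c) 0) / t)
        (𝓝[>] 0) (𝓝 v) := fun hev => by
    refine tendsto_const_nhds.congr' ?_
    filter_upwards [hev, self_mem_nhdsWithin] with t a b
    rw [max_eq_left (by linarith [a.2]), max_eq_left (by linarith [a.1]), eq_div_iff (ne_of_gt b)]
    ring
  have hdn : (∀ᶠ t in 𝓝[>] (0 : ℝ), ξ + √t * σ ≤ c ∧ ξ + √t * σ + t * v ≤ c) →
      Tendsto (fun t : ℝ => (max (ξ + √t * σ + t * v - c) 0 - max (ξ + √t * σ - c) 0) / t)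
        (𝓝[>] 0) (𝓝 0) := fun hev => by
    refine tendsto_const_nhds.congr' ?_
    filter_upwards [hev] with t a
    rw [max_eq_right (by linarith [a.2]), max_eq_right (by linarith [a.1])]
    simp
  rcases lt_trichotomy c ξ with hc | hc | hc
  · rw [if_pos (Or.inl hc), one_mul]
    apply hup
    filter_upwards [h1.eventually (Ioi_mem_nhds hc), h2.eventually (Ioi_mem_nhds hc)] with t a b
      using ⟨le_of_lt a, le_of_lt b⟩
  · rcases hσ with rfl | rfl
    · rw [if_pos (Or.inr ⟨hc, rfl⟩), one_mul]
      apply hup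
      filter_upwards [h3] with t a
      have := (abs_lt.1 a).1
      constructor <;> nlinarith [Real.sqrt_nonneg t]
    · rw [if_neg (by rintro (a | a); exacts [absurd hc a.ne, by norm_num at a]), zero_mul]
      apply hdn
      filter_upwards [h3] with t a
      have := (abs_lt.1 a).2
      constructor <;> nlinarith [Real.sqrt_nonneg t]
  · rw [if_neg (by rintro (a | a); exacts [lt_asymm hc a, absurd a.1 hc.ne']), zero_mul]
    apply hdn
    filter_upwards [h1.eventually (Iio_mem_nhds hc), h2.eventually (Iio_mem_nhds hc)] with t a b
      using ⟨le_of_lt a, le_of_lt b⟩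

lemma tendsto_jumpPrimitive_slope {L : ℝ≥0} (hgL : LipschitzWith L gL) (ξ v : ℝ) {σ : ℝ}
    (hσ : σ = 1 ∨ σ = -1) :
    Tendsto (fun t : ℝ => (jumpPrimitive gL α h (ξ + √t * σ + t * v) -
      jumpPrimitive gL α h (ξ + √t * σ)) / t) (𝓝[>] 0)
      (𝓝 ((if σ = 1 then jumpRight gL α h ξ else jumpLeft gL α h ξ) * v)) := by
  have hsq : Tendsto (fun t : ℝ => √t) (𝓝[>] 0) (𝓝 0) := by
    have := (Real.continuous_sqrt.tendsto 0).mono_left (nhdsWithin_le_nhds (s := Ioi 0))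
    simpa using this
  have hid : Tendsto (fun t : ℝ => t) (𝓝[>] 0) (𝓝 0) := nhdsWithin_le_nhds
  have hI : Tendsto (fun t : ℝ => ((∫ r in (0 : ℝ)..(ξ + √t * σ + t * v), gL r) -
      ∫ r in (0 : ℝ)..(ξ + √t * σ), gL r) / t) (𝓝[>] 0) (𝓝 (gL ξ * v)) := by
    rw [tendsto_iff_norm_sub_tendsto_zero]
    have hb : Tendsto (fun t : ℝ => L * (√t + t * |v|) * |v|) (𝓝[>] 0) (𝓝 0) := by
      simpa using ((hsq.add (hid.mul_const |v|)).const_mul (L : ℝ)).mul_const |v|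
    refine squeeze_zero' (.of_forall fun _ => norm_nonneg _) ?_ hb
    filter_upwards [self_mem_nhdsWithin] with t ht
    rw [mem_Ioi] at ht
    have := abs_integral_sub_mul_le hgL (ξ + √t * σ) (ξ + √t * σ + t * v) ξ
    have hσ1 : |σ| = 1 := by rcases hσ with rfl | rfl <;> simp
    rw [add_sub_cancel_left, add_sub_cancel_left, abs_mul (√t), hσ1, mul_one,
      abs_of_nonneg (Real.sqrt_nonneg t), abs_mul t, abs_of_pos ht] at this
    rw [Real.norm_eq_abs, div_sub' ht.ne', abs_div, abs_of_pos ht, div_le_iff₀ ht]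
    calc _ = _ := by ring_nf
      _ ≤ _ := this
      _ = _ := by ring
  have hS := tendsto_finsetSum Finset.univ
    fun l (_ : l ∈ Finset.univ) => (tendsto_ramp_slope (h l) ξ v hσ).const_mul (α l)
  have e : (if σ = 1 then jumpRight gL α h ξ else jumpLeft gL α h ξ) * v = gL ξ * v +
      ∑ l, α l * ((if h l < ξ ∨ (h l = ξ ∧ σ = 1) then 1 else 0) * v) := by
    simp_rw [← mul_assoc, ← Finset.sum_mul, ← add_mul]
    congr 1
    rcases hσ with rfl | rfl
    · simp only [if_true, and_true, ← le_iff_lt_or_eq, jumpRight]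
    · rw [if_neg (by norm_num), jumpLeft]
      congr 1
      refine Finset.sum_congr rfl fun l _ => ?_
      norm_num
  rw [e]
  refine (hI.add hS).congr fun t => ?_
  unfold jumpPrimitive
  simp_rw [mul_div_assoc', mul_sub, ← Finset.sum_div, Finset.sum_sub_distrib]
  ring

/-! ### The Casimir functional and its Clarke gradient -/

variable {Ω : Set Plane}

lemma integrable_abs_mul_abs (f g : L2 Ω) :
    Integrable (fun x => |f x| * |g x|) (volume.restrict Ω) :=
  MemLp.integrable_mul (Lp.memLp f).norm (Lp.memLp g).norm

lemma integral_abs_mul_abs_le (f g : L2 Ω) : ∫ x in Ω, |f x| * |g x| ≤ ‖f‖ * ‖g‖ := by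
  have h := real_inner_le_norm |f| |g|
  rw [L2.inner_def, norm_abs_eq_norm, norm_abs_eq_norm] at h
  refine le_trans (le_of_eq (integral_congr_ae ?_)) h
  filter_upwards [Lp.coeFn_abs f, Lp.coeFn_abs g] with x a b
  rw [a, b]; simp [mul_comm]

section FiniteMeasure

variable [IsFiniteMeasure (volume.restrict Ω)]

/-- The constant function `1` as an element of `L²(Ω)`. -/
def oneL2 (Ω : Set Plane) [IsFiniteMeasure (volume.restrict Ω)] : L2 Ω :=
  (memLp_const (1 : ℝ)).toLp (fun _ => 1)

lemma coeFn_oneL2 : (oneL2 Ω : Plane → ℝ) =ᵐ[volume.restrict Ω] fun _ => 1 :=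
  MemLp.coeFn_toLp _

lemma integral_abs_le_norm (f : L2 Ω) : ∫ x in Ω, |f x| ≤ ‖oneL2 Ω‖ * ‖f‖ := by
  refine le_trans (le_of_eq (integral_congr_ae ?_)) (integral_abs_mul_abs_le (oneL2 Ω) f)
  filter_upwards [coeFn_oneL2 (Ω := Ω)] with x a
  rw [a]; simp

lemma integrable_L2 (f : L2 Ω) : Integrable f (volume.restrict Ω) :=
  (Lp.memLp f).integrable one_le_two

lemma integrable_growth (u v : L2 Ω) :
    Integrable (fun x => (1 + |u x| + |v x|) * |v x - u x|) (volume.restrict Ω) := by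
  have h1 := ((integrable_L2 (v - u)).abs.add (integrable_abs_mul_abs u (v - u))).add
    (integrable_abs_mul_abs v (v - u))
  refine h1.congr ?_
  filter_upwards [Lp.coeFn_sub v u] with x a
  simp only [Pi.add_apply, a, Pi.sub_apply]
  ring

lemma integral_growth_le (u v : L2 Ω) :
    ∫ x in Ω, (1 + |u x| + |v x|) * |v x - u x| ≤ (‖oneL2 Ω‖ + ‖u‖ + ‖v‖) * ‖v - u‖ := by
  have e : ∫ x in Ω, (1 + |u x| + |v x|) * |v x - u x| =
      (∫ x in Ω, |(v - u) x|) + (∫ x in Ω, |u x| * |(v - u) x|) +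
        ∫ x in Ω, |v x| * |(v - u) x| := by
    have h1 : Integrable (fun x => |(v - u) x| + |u x| * |(v - u) x|) (volume.restrict Ω) :=
      (integrable_L2 (v - u)).abs.add (integrable_abs_mul_abs u (v - u))
    rw [← integral_add (integrable_L2 (v - u)).abs (integrable_abs_mul_abs u (v - u)),
      ← integral_add h1 (integrable_abs_mul_abs v (v - u))]
    refine integral_congr_ae ?_
    filter_upwards [Lp.coeFn_sub v u] with x a
    simp only [a, Pi.sub_apply]
    ring
  rw [e, add_mul, add_mul]
  exact add_le_add (add_le_add (integral_abs_le_norm _) (integral_abs_mul_abs_le _ _))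
    (integral_abs_mul_abs_le _ _)

variable {G : ℝ → ℝ} {C : ℝ}

lemma integrable_comp_of_growth (hGc : Continuous G)
    (hC : ∀ a b, |G b - G a| ≤ C * (1 + |a| + |b|) * |b - a|) (u : L2 Ω) :
    Integrable (fun x => G (u x)) (volume.restrict Ω) := by
  have h1 : Integrable (fun x => |G 0| + C * ((1 + |(0 : L2 Ω) x| + |u x|) *
      |u x - (0 : L2 Ω) x|)) (volume.restrict Ω) :=
    (integrable_const _).add ((integrable_growth 0 u).const_mul C)
  refine h1.mono' (hGc.comp_aestronglyMeasurable (Lp.aestronglyMeasurable u)) ?_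
  filter_upwards [Lp.coeFn_zero ℝ 2 (volume.restrict Ω)] with x a
  have := hC 0 (u x)
  have h2 : |G (u x)| ≤ |G 0| + |G (u x) - G 0| := by
    simpa using abs_add_le (G 0) (G (u x) - G 0)
  rw [Real.norm_eq_abs, a, Pi.zero_apply, ← mul_assoc]
  linarith

lemma locallyLipschitz_casimir (hGc : Continuous G) (hC0 : 0 ≤ C)
    (hC : ∀ a b, |G b - G a| ≤ C * (1 + |a| + |b|) * |b - a|) :
    LocallyLipschitz (casimir Ω G) := by
  have key : ∀ u v : L2 Ω, |casimir Ω G v - casimir Ω G u| ≤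
      C * ((‖oneL2 Ω‖ + ‖u‖ + ‖v‖) * ‖v - u‖) := fun u v => by
    unfold casimir
    rw [← integral_sub (integrable_comp_of_growth hGc hC v) (integrable_comp_of_growth hGc hC u)]
    refine (abs_integral_le_integral_abs).trans ?_
    refine le_trans (integral_mono ((integrable_comp_of_growth hGc hC v).sub
      (integrable_comp_of_growth hGc hC u)).abs ((integrable_growth u v).const_mul C)
      fun x => ?_) ?_
    · simpa [mul_assoc] using hC (u x) (v x)
    · rw [integral_const_mul]
      exact mul_le_mul_of_nonneg_left (integral_growth_le u v) hC0
  intro u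
  refine ⟨(C * (‖oneL2 Ω‖ + (‖u‖ + 1) + (‖u‖ + 1))).toNNReal, Metric.ball u 1,
    Metric.ball_mem_nhds u one_pos, LipschitzOnWith.of_dist_le_mul fun a ha b hb => ?_⟩
  have hn : ∀ w ∈ Metric.ball u 1, ‖w‖ ≤ ‖u‖ + 1 := fun w hw => by
    have h1 := norm_le_norm_add_norm_sub' w u
    rw [mem_ball_iff_norm] at hw
    linarith
  rw [Real.coe_toNNReal _ (by positivity), Real.dist_eq, dist_eq_norm, mul_assoc]
  refine (key b a).trans (mul_le_mul_of_nonneg_left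
    (mul_le_mul_of_nonneg_right ?_ (norm_nonneg _)) hC0)
  linarith [hn a ha, hn b hb]

lemma memLp_comp_lipschitz {L : ℝ≥0} (hgL : LipschitzWith L gL) (w : L2 Ω) :
    MemLp (fun x => gL (w x)) 2 (volume.restrict Ω) := by
  refine ((memLp_const |gL 0|).add ((Lp.memLp w).norm.const_mul (L : ℝ))).mono'
    (hgL.continuous.comp_aestronglyMeasurable (Lp.aestronglyMeasurable w)) (.of_forall fun x => ?_)
  have h1 := hgL.dist_le_mul (w x) 0
  rw [Real.dist_eq, Real.dist_eq, sub_zero] at h1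
  have h2 : |gL (w x)| ≤ |gL 0| + |gL (w x) - gL 0| := by
    simpa using abs_add_le (gL 0) (gL (w x) - gL 0)
  simp only [Real.norm_eq_abs, Pi.add_apply]
  linarith

lemma measurable_jumpLeft (hc : Continuous gL) : Measurable (jumpLeft gL α h) :=
  hc.measurable.add (Finset.measurable_fun_sum _ fun _ _ => (Measurable.ite
    (measurableSet_lt measurable_const measurable_id) measurable_const
      measurable_const).const_mul _)

lemma measurable_jumpRight (hc : Continuous gL) : Measurable (jumpRight gL α h) :=
  hc.measurable.add (Finset.measurable_fun_sum _ fun _ _ => (Measurable.ite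
    (measurableSet_le measurable_const measurable_id) measurable_const
      measurable_const).const_mul _)

lemma memLp_jumpLeft_comp {L : ℝ≥0} (hgL : LipschitzWith L gL) (w : L2 Ω) :
    MemLp (fun x => jumpLeft gL α h (w x)) 2 (volume.restrict Ω) := by
  refine ((memLp_comp_lipschitz hgL w).norm.add (memLp_const (∑ l, |α l|))).mono'
    ((measurable_jumpLeft hgL.continuous).comp_aemeasurable
      (Lp.aestronglyMeasurable w).aemeasurable).aestronglyMeasurable (.of_forall fun x => ?_)
  unfold jumpLeft
  refine (norm_add_le _ _).trans (add_le_add le_rfl ((norm_sum_le _ _).trans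
    (Finset.sum_le_sum fun l _ => ?_)))
  split_ifs <;> simp

/-- The averaged form of the slope bound: on a measurable set, `±1` times an element of the Clarke
gradient of the Casimir functional is dominated in the mean by the slopes of `G` near `w`. -/
lemma setIntegral_clarkeGradient_le {L : ℝ≥0} (hgL : LipschitzWith L gL) {c : ℝ}
    (hG : ∀ ξ, G ξ = c + jumpPrimitive gL α h ξ)
    (hint : ∀ u : L2 Ω, Integrable (fun x => G (u x)) (volume.restrict Ω))
    {w ψ : L2 Ω} (hψ : ψ ∈ clarkeGradient (casimir Ω G) w) {s δ : ℝ} (hs : |s| = 1) (hδ : 0 < δ)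
    {A : Set Plane} (hA : MeasurableSet A) :
    ∫ x in A, s * ψ x ∂(volume.restrict Ω) ≤
      ∫ x in A, (s * gL (w x) + ∑ l, rampSlopeBound (s * α l) (h l) δ (w x))
        ∂(volume.restrict Ω) := by
  set v : L2 Ω := indicatorConstLp 2 hA (measure_ne_top _ A) s with hv
  set B : Plane → ℝ := fun x => s * gL (w x) + ∑ l, rampSlopeBound (s * α l) (h l) δ (w x)
  set M : ℝ := L + (∑ l, |α l|) * (4 / δ)
  have hM : 0 ≤ M := by positivity
  have hB : Integrable B (volume.restrict Ω) := by
    refine (((memLp_comp_lipschitz hgL w).integrable one_le_two).const_mul s).add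
      (integrable_finsetSum _ fun l _ => ?_)
    refine Integrable.of_bound ((measurable_rampSlopeBound _ _ _).comp_aemeasurable
      (Lp.aestronglyMeasurable w).aemeasurable).aestronglyMeasurable |s * α l|
      (.of_forall fun x => abs_rampSlopeBound_le _ _ _ _)
  set V : ℝ := (volume.restrict Ω).real univ
  have hbound : ∀ u : L2 Ω, ∀ t : ℝ, 0 < t → t ≤ δ / 2 →
      (casimir Ω G (u + t • v) - casimir Ω G u) / t ≤
        (∫ x in A, B x ∂(volume.restrict Ω)) + (L * t * V + M * (‖oneL2 Ω‖ * ‖u - w‖)) := by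
    intro u t ht htδ
    have hI : Integrable (fun x => L * t + M * |(u - w) x|) (volume.restrict Ω) :=
      (integrable_const _).add ((integrable_L2 (u - w)).abs.const_mul M)
    have h1 : (casimir Ω G (u + t • v) - casimir Ω G u) / t ≤
        ∫ x in Ω, (A.indicator B x + (L * t + M * |(u - w) x|)) := by
      unfold casimir
      rw [← integral_sub (hint _) (hint _), ← integral_div]
      refine integral_mono_ae (((hint _).sub (hint _)).div_const t)
        ((hB.indicator hA).add hI) ?_
      filter_upwards [Lp.coeFn_add u (t • v), Lp.coeFn_smul t v, Lp.coeFn_sub u w,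
        indicatorConstLp_coeFn (p := 2) (hs := hA) (hμs := measure_ne_top (volume.restrict Ω) A)
          (c := s)] with x e1 e2 e3 e4
      rw [e1, Pi.add_apply, e2, Pi.smul_apply, hv, e4, e3, Pi.sub_apply, smul_eq_mul]
      by_cases hx : x ∈ A
      · rw [indicator_of_mem hx, indicator_of_mem hx, hG, hG, add_sub_add_left_eq_sub, ← add_assoc]
        exact jumpPrimitive_slope_le hgL hs ht htδ (u x) (w x)
      · rw [indicator_of_notMem hx, indicator_of_notMem hx]
        simp only [mul_zero, add_zero, sub_self, zero_div, zero_add]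
        positivity
    refine h1.trans ?_
    rw [integral_add (hB.indicator hA) hI, integral_indicator hA, integral_add (integrable_const _)
      ((integrable_L2 (u - w)).abs.const_mul M), integral_const, smul_eq_mul,
      integral_const_mul, mul_comm V]
    have := mul_le_mul_of_nonneg_left (integral_abs_le_norm (u - w)) hM
    linarith
  have hlim : Tendsto (fun p : L2 Ω × ℝ => (((∫ x in A, B x ∂(volume.restrict Ω)) +
      (L * p.2 * V + M * (‖oneL2 Ω‖ * ‖p.1 - w‖)) : ℝ) : EReal)) (𝓝 w ×ˢ 𝓝[>] (0 : ℝ))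
      (𝓝 ((∫ x in A, B x ∂(volume.restrict Ω) : ℝ) : EReal)) := by
    refine (continuous_coe_real_ereal.tendsto _).comp ?_
    have hcont : Continuous (fun p : L2 Ω × ℝ => (∫ x in A, B x ∂(volume.restrict Ω)) +
      (L * p.2 * V + M * (‖oneL2 Ω‖ * ‖p.1 - w‖))) := by fun_prop
    have := hcont.tendsto (w, 0)
    rw [nhds_prod_eq] at this
    simp only [mul_zero, zero_mul, sub_self, norm_zero, add_zero] at this
    exact this.mono_left (Filter.prod_mono le_rfl nhdsWithin_le_nhds)
  have hle : clarkeDirDeriv (casimir Ω G) w v ≤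
      ((∫ x in A, B x ∂(volume.restrict Ω) : ℝ) : EReal) := by
    rw [← hlim.limsup_eq]
    refine limsup_le_limsup ?_
    have ht : ∀ᶠ t in 𝓝[>] (0 : ℝ), 0 < t ∧ t ≤ δ / 2 := by
      filter_upwards [self_mem_nhdsWithin,
        mem_nhdsWithin_of_mem_nhds (Iic_mem_nhds (half_pos hδ))] with t a b using ⟨a, b⟩
    filter_upwards [ht.prod_inr (𝓝 w)] with p hp
    exact EReal.coe_le_coe_iff.2 (hbound p.1 p.2 hp.1 hp.2)
  have h2 := EReal.coe_le_coe_iff.1 ((hψ v).trans hle)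
  rw [real_inner_comm, hv, L2.inner_indicatorConstLp_eq_inner_setIntegral] at h2
  rw [integral_const_mul]
  simpa [mul_comm] using h2

/-- Elements of the Clarke gradient of the Casimir functional are selections of `g ∘ w`. -/
theorem ae_mem_of_mem_clarkeGradient {L : ℝ≥0} (hgL : LipschitzWith L gL) {c : ℝ}
    (hG : ∀ ξ, G ξ = c + jumpPrimitive gL α h ξ)
    (hint : ∀ u : L2 Ω, Integrable (fun x => G (u x)) (volume.restrict Ω))
    (hconv : ∀ ξ, Convex ℝ (jumpFunction gL α h ξ))
    {w ψ : L2 Ω} (hψ : ψ ∈ clarkeGradient (casimir Ω G) w) :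
    ∀ᵐ x ∂(volume.restrict Ω), ψ x ∈ jumpFunction gL α h (w x) := by
  have key : ∀ s : ℝ, |s| = 1 → ∀ᵐ x ∂(volume.restrict Ω),
      ∃ y ∈ jumpFunction gL α h (w x), s * ψ x ≤ s * y := by
    intro s hs
    have h1 : ∀ᵐ x ∂(volume.restrict Ω), ∀ n : ℕ, s * ψ x ≤
        s * gL (w x) + ∑ l, rampSlopeBound (s * α l) (h l) (1 / ((n : ℝ) + 1)) (w x) := by
      refine ae_all_iff.2 fun n => ?_
      refine ae_le_of_forall_setIntegral_le ((integrable_L2 ψ).const_mul s) ?_ fun A hA _ =>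
        setIntegral_clarkeGradient_le hgL hG hint hψ hs Nat.one_div_pos_of_nat hA
      refine (((memLp_comp_lipschitz hgL w).integrable one_le_two).const_mul s).add
        (integrable_finsetSum _ fun l _ => ?_)
      exact Integrable.of_bound ((measurable_rampSlopeBound _ _ _).comp_aemeasurable
        (Lp.aestronglyMeasurable w).aemeasurable).aestronglyMeasurable |s * α l|
        (.of_forall fun x => abs_rampSlopeBound_le _ _ _ _)
    filter_upwards [h1] with x hx
    obtain ⟨y, hy, hev⟩ :=
      exists_mem_jumpFunction_rampSlopeBound (gL := gL) (α := α) (h := h) s (w x)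
    have ht : Tendsto (fun n : ℕ => 1 / ((n : ℝ) + 1)) atTop (𝓝[>] 0) :=
      tendsto_nhdsWithin_iff.2 ⟨tendsto_one_div_add_atTop_nhds_zero_nat,
        .of_forall fun n => mem_Ioi.2 Nat.one_div_pos_of_nat⟩
    obtain ⟨n, hn⟩ := (ht.eventually hev).exists
    exact ⟨y, hy, hn ▸ hx n⟩
  filter_upwards [key 1 (by simp), key (-1) (by simp)] with x ⟨a, ha, ha'⟩ ⟨b, hb, hb'⟩
  exact (hconv (w x)).ordConnected.out hb ha ⟨by linarith, by linarith⟩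

/-- Selections of `g ∘ w` belong to the Clarke gradient of the Casimir functional: for a direction
`v`, the base points `w + √t σ`, with the sign `σ` chosen at each point according to which of the
one-sided derivatives of `G` is larger in direction `v`, realize the pointwise maximum. -/
theorem mem_clarkeGradient_of_ae_mem {L : ℝ≥0} (hgL : LipschitzWith L gL) {c : ℝ}
    (hG : ∀ ξ, G ξ = c + jumpPrimitive gL α h ξ)
    (hint : ∀ u : L2 Ω, Integrable (fun x => G (u x)) (volume.restrict Ω))
    {w ψ : L2 Ω} (hψ : ∀ᵐ x ∂(volume.restrict Ω),
      ψ x ∈ uIcc (jumpLeft gL α h (w x)) (jumpRight gL α h (w x))) :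
    ψ ∈ clarkeGradient (casimir Ω G) w := by
  intro v
  have hmw : Measurable w := (Lp.stronglyMeasurable w).measurable
  have hmv : Measurable v := (Lp.stronglyMeasurable v).measurable
  have hmψ : Measurable ψ := (Lp.stronglyMeasurable ψ).measurable
  set σ : Plane → ℝ := fun x => if ψ x * v x ≤ jumpRight gL α h (w x) * v x then 1 else -1
  have hσ : ∀ x, σ x = 1 ∨ σ x = -1 := fun x => by
    by_cases hx : ψ x * v x ≤ jumpRight gL α h (w x) * v x <;> simp [σ, hx]
  have hσa : ∀ x, |σ x| = 1 := fun x => by rcases hσ x with e | e <;> simp [e]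
  have hmσ : Measurable σ := Measurable.ite (measurableSet_le (hmψ.mul hmv)
    (((measurable_jumpRight hgL.continuous).comp hmw).mul hmv)) measurable_const measurable_const
  have hLσ : MemLp σ 2 (volume.restrict Ω) :=
    MemLp.of_bound hmσ.aestronglyMeasurable 1 (.of_forall fun x => (hσa x).le)
  set S : L2 Ω := hLσ.toLp σ
  set γ : Plane → ℝ := fun x =>
    if σ x = 1 then jumpRight gL α h (w x) else jumpLeft gL α h (w x)
  have hpath : Tendsto (fun t : ℝ => (w + √t • S, t)) (𝓝[>] 0) (𝓝 w ×ˢ 𝓝[>] (0 : ℝ)) := by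
    refine Tendsto.prodMk ?_ tendsto_id
    have hc : Continuous (fun t : ℝ => w + √t • S) :=
      continuous_const.add (Real.continuous_sqrt.smul continuous_const)
    have := (hc.tendsto 0).mono_left (nhdsWithin_le_nhds (s := Ioi 0))
    simpa using this
  have hquot : ∀ t : ℝ, (casimir Ω G (w + √t • S + t • v) - casimir Ω G (w + √t • S)) / t =
      ∫ x in Ω, (G (w x + √t * σ x + t * v x) - G (w x + √t * σ x)) / t := fun t => by
    unfold casimir
    rw [← integral_sub (hint _) (hint _), ← integral_div]
    refine integral_congr_ae ?_
    filter_upwards [Lp.coeFn_add (w + √t • S) (t • v), Lp.coeFn_add w (√t • S),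
      Lp.coeFn_smul t v, Lp.coeFn_smul (√t) S, hLσ.coeFn_toLp] with x e1 e2 e3 e4 e5
    simp only [e1, e2, e3, e4, e5, Pi.add_apply, Pi.smul_apply, smul_eq_mul, S]
  obtain ⟨C, hC0, hC⟩ := exists_abs_jumpPrimitive_sub_le (α := α) (h := h) hgL
  have hprim : ∀ a b, G b - G a = jumpPrimitive gL α h b - jumpPrimitive gL α h a := fun a b => by
    rw [hG, hG]; ring
  have hmG : Measurable G := by
    rw [funext hG]
    exact (continuous_const.add
      (locallyLipschitz_jumpPrimitive hgL.continuous).continuous).measurable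
  have hlim : Tendsto (fun t : ℝ =>
      ∫ x in Ω, (G (w x + √t * σ x + t * v x) - G (w x + √t * σ x)) / t) (𝓝[>] 0)
      (𝓝 (∫ x in Ω, γ x * v x)) := by
    refine tendsto_integral_filter_of_dominated_convergence
      (fun x => C * (3 * |v x| + 2 * (|w x| * |v x|) + |v x| * |v x|)) ?_ ?_ ?_ ?_
    · refine .of_forall fun t => Measurable.aestronglyMeasurable ?_
      exact ((hmG.comp ((hmw.add (hmσ.const_mul _)).add (hmv.const_mul _))).sub
        (hmG.comp (hmw.add (hmσ.const_mul _)))).div_const t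
    · filter_upwards [self_mem_nhdsWithin,
        mem_nhdsWithin_of_mem_nhds (Iic_mem_nhds one_pos)] with t ht ht1
      rw [mem_Ioi] at ht
      rw [mem_Iic] at ht1
      refine .of_forall fun x => ?_
      have h1 := hC (w x + √t * σ x) (w x + √t * σ x + t * v x)
      rw [add_sub_cancel_left, abs_mul t, abs_of_pos ht] at h1
      rw [Real.norm_eq_abs, hprim, abs_div, abs_of_pos ht, div_le_iff₀ ht]
      refine h1.trans ?_
      have h2 : |w x + √t * σ x| ≤ |w x| + 1 := by
        refine (abs_add_le _ _).trans (add_le_add le_rfl ?_)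
        rw [abs_mul, hσa, mul_one, abs_of_nonneg (Real.sqrt_nonneg t)]
        exact Real.sqrt_le_one.2 ht1
      have h3 : |w x + √t * σ x + t * v x| ≤ |w x| + 1 + |v x| := by
        refine (abs_add_le _ _).trans (add_le_add h2 ?_)
        rw [abs_mul, abs_of_pos ht]
        exact mul_le_of_le_one_left (abs_nonneg _) ht1
      calc C * (1 + |w x + √t * σ x| + |w x + √t * σ x + t * v x|) * (t * |v x|)
          ≤ C * (1 + (|w x| + 1) + (|w x| + 1 + |v x|)) * (t * |v x|) := by gcongr
        _ = _ := by ring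
    · exact ((((integrable_L2 v).abs.const_mul 3).add
        ((integrable_abs_mul_abs w v).const_mul 2)).add (integrable_abs_mul_abs v v)).const_mul C
    · refine .of_forall fun x => ?_
      simp_rw [hprim]
      exact tendsto_jumpPrimitive_slope hgL (w x) (v x) (hσ x)
  have hγ : Integrable (fun x => γ x * v x) (volume.restrict Ω) := by
    have hml : MemLp (fun x => |gL (w x)| + ∑ l, |α l|) 2 (volume.restrict Ω) :=
      (memLp_comp_lipschitz hgL w).norm.add (memLp_const (∑ l, |α l|))
    refine MemLp.integrable_mul (p := 2) (q := 2) (hml.mono' (Measurable.ite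
      (hmσ (measurableSet_singleton 1)) ((measurable_jumpRight hgL.continuous).comp hmw)
      ((measurable_jumpLeft hgL.continuous).comp hmw)).aestronglyMeasurable
        (.of_forall fun x => ?_)) (Lp.memLp v)
    have : ∀ p : Fin ν → Prop, ∀ [DecidablePred p],
        |gL (w x) + ∑ l, α l * (if p l then 1 else 0)| ≤ |gL (w x)| + ∑ l, |α l| := by
      intro p _
      refine (abs_add_le _ _).trans (add_le_add le_rfl ((Finset.abs_sum_le_sum_abs _ _).trans
        (Finset.sum_le_sum fun l _ => ?_)))
      split_ifs <;> simp
    by_cases hx : σ x = 1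
    · rw [Real.norm_eq_abs, show γ x = jumpRight gL α h (w x) from if_pos hx]
      exact this (fun l => h l ≤ w x)
    · rw [Real.norm_eq_abs, show γ x = jumpLeft gL α h (w x) from if_neg hx]
      exact this (fun l => h l < w x)
  have hle : inner ℝ ψ v ≤ ∫ x in Ω, γ x * v x := by
    rw [L2.inner_def]
    refine integral_mono_ae (L2.integrable_inner ψ v) hγ ?_
    filter_upwards [hψ] with x hx
    simp only [RCLike.inner_apply, conj_trivial]
    by_cases hr : ψ x * v x ≤ jumpRight gL α h (w x) * v x
    · simp only [γ, σ, hr, if_true]; linarith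
    · have hγx : γ x = jumpLeft gL α h (w x) := by
        simp only [γ, σ, hr, if_false]; norm_num
      rw [hγx, mul_comm]
      rw [not_le] at hr
      rcases mem_uIcc.1 hx with ⟨h1, h2⟩ | ⟨h1, h2⟩ <;> rcases le_total 0 (v x) with h0 | h0
      · linarith [mul_le_mul_of_nonneg_right h2 h0]
      · exact mul_le_mul_of_nonpos_right h1 h0
      · exact mul_le_mul_of_nonneg_right h2 h0
      · linarith [mul_le_mul_of_nonpos_right h1 h0]
  refine (EReal.coe_le_coe_iff.2 hle).trans ?_
  have hlim' := (continuous_coe_real_ereal.tendsto _).comp hlim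
  rw [← hlim'.limsup_eq]
  refine le_trans (le_of_eq ?_) (limsup_le_limsup_of_le hpath (f := 𝓝[>] (0:ℝ) |>.map _))
  rw [limsup, limsup, Filter.map_map]
  congr 2
  funext t
  simp only [Function.comp, hquot]

end FiniteMeasure

/-! ### The bracket and the kernel of the Poisson operator -/

lemma gradient_apply_eq_fderiv (f : Plane → ℝ) (x : Plane) (i : Fin 2) :
    gradient f x i = fderiv ℝ f x (EuclideanSpace.single i 1) := by
  have h1 := InnerProductSpace.toDual_symm_apply (𝕜 := ℝ) (x := EuclideanSpace.single i (1 : ℝ))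
    (y := fderiv ℝ f x)
  rw [← h1, EuclideanSpace.inner_single_right]
  simp [gradient]

lemma norm_gradient_le_of_lipschitz {C : ℝ≥0} {W : Plane → ℝ} (hW : LipschitzWith C W)
    (x : Plane) : ‖gradient W x‖ ≤ C := by
  rw [gradient, LinearIsometryEquiv.norm_map]
  exact norm_fderiv_le_of_lipschitz ℝ hW

lemma measurable_gradient (W : Plane → ℝ) : Measurable (gradient W) :=
  (LinearIsometryEquiv.continuous _).measurable.comp (measurable_fderiv ℝ W)

lemma gradient_eq_zero_of_notMem_tsupport {f : Plane → ℝ} {x : Plane} (hx : x ∉ tsupport f) :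
    gradient f x = 0 := by
  rw [gradient, fderiv_of_notMem_tsupport ℝ hx, map_zero]

lemma contDiff_gradient_apply {f : Plane → ℝ} (hf : ContDiff ℝ ((⊤ : ℕ∞) : WithTop ℕ∞) f)
    (i : Fin 2) : ContDiff ℝ ((⊤ : ℕ∞) : WithTop ℕ∞) (fun x => gradient f x i) := by
  simp_rw [gradient_apply_eq_fderiv]
  exact (hf.fderiv_right (by simp)).clm_apply contDiff_const

lemma hasCompactSupport_gradient_apply {f : Plane → ℝ} (hf : HasCompactSupport f) (i : Fin 2) :
    HasCompactSupport (fun x => gradient f x i) :=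
  hf.mono' fun x hx => by
    by_contra hc
    exact hx (by simp [gradient_eq_zero_of_notMem_tsupport hc])

/-- Mixed second partial derivatives commute. -/
lemma gradient_gradient_comm {f : Plane → ℝ} (hf : ContDiff ℝ ((⊤ : ℕ∞) : WithTop ℕ∞) f)
    (i j : Fin 2) (x : Plane) :
    gradient (fun y => gradient f y i) x j = gradient (fun y => gradient f y j) x i := by
  have hd : DifferentiableAt ℝ (fderiv ℝ f) x :=
    (hf.fderiv_right (m := ((⊤ : ℕ∞) : WithTop ℕ∞)) (by simp)).differentiable (by simp) x
  have hs : IsSymmSndFDerivAt ℝ f x := hf.contDiffAt.isSymmSndFDerivAt (by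
    rw [minSmoothness_of_isRCLikeNormedField]; exact WithTop.coe_le_coe.2 (le_top (a := (2 : ℕ∞))))
  have key : ∀ i j : Fin 2, gradient (fun y => gradient f y i) x j =
      fderiv ℝ (fderiv ℝ f) x (EuclideanSpace.single j 1) (EuclideanSpace.single i 1) := by
    intro i j
    rw [gradient_apply_eq_fderiv]
    simp_rw [gradient_apply_eq_fderiv]
    rw [fderiv_clm_apply hd (differentiableAt_const _)]
    simp
  rw [key, key, hs.eq]

lemma gradient_mul_apply {f g : Plane → ℝ} {x : Plane} (hf : DifferentiableAt ℝ f x)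
    (hg : DifferentiableAt ℝ g x) (i : Fin 2) :
    gradient (fun y => f y * g y) x i = gradient f x i * g x + f x * gradient g x i := by
  simp_rw [gradient_apply_eq_fderiv]
  rw [fderiv_fun_mul hf hg]
  simp [mul_comm]
  ring

lemma integrable_gradient_mul {C : ℝ≥0} {W : Plane → ℝ} (hW : LipschitzWith C W)
    {g : Plane → ℝ} (hg : Continuous g) (hgs : HasCompactSupport g) (i : Fin 2) :
    Integrable (fun x => gradient W x i * g x) := by
  refine (hg.integrable_of_hasCompactSupport hgs).bdd_mul (c := C) ?_ (.of_forall fun x => ?_)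
  · have hp : Measurable fun p : Plane => p i := by fun_prop
    exact (hp.comp (measurable_gradient W)).aestronglyMeasurable
  · exact (PiLp.norm_apply_le _ i).trans (norm_gradient_le_of_lipschitz hW x)

lemma integral_gradient_mul {C : ℝ≥0} {W : Plane → ℝ} (hW : LipschitzWith C W)
    {g : Plane → ℝ} (hg : ContDiff ℝ ((⊤ : ℕ∞) : WithTop ℕ∞) g) (hgs : HasCompactSupport g)
    (i : Fin 2) : ∫ x, gradient W x i * g x = -∫ x, W x * gradient g x i := by
  obtain ⟨D, hD⟩ := (hg.of_le (by simp)).lipschitzWith_of_hasCompactSupport hgs (n := 1) (by simp)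
  have h1 := hW.integral_lineDeriv_mul_eq (μ := volume) hD hgs (EuclideanSpace.single i 1)
  have h2 : ∫ x, gradient W x i * g x =
      ∫ x, lineDeriv ℝ W x (EuclideanSpace.single i 1) * g x := by
    refine integral_congr_ae ?_
    filter_upwards [hW.ae_differentiableAt] with x hx
    rw [gradient_apply_eq_fderiv, hx.lineDeriv_eq_fderiv]
  rw [h2, h1, ← integral_neg]
  refine integral_congr_ae (.of_forall fun x => ?_)
  have hx : DifferentiableAt ℝ g x := hg.differentiable (by simp) x
  dsimp only
  rw [gradient_apply_eq_fderiv, hx.lineDeriv_eq_fderiv, map_neg]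
  ring

/-- Integration by parts for the bracket: `∫ χ {W, φ} = -∫ W {χ, φ}`. The second derivatives of
`φ` cancel, so a Lipschitz function `W` is regular enough. -/
theorem integral_mul_bracket_gradient {C : ℝ≥0} {W : Plane → ℝ} (hW : LipschitzWith C W)
    {χ φ : Plane → ℝ} (hχ : ContDiff ℝ ((⊤ : ℕ∞) : WithTop ℕ∞) χ)
    (hφ : ContDiff ℝ ((⊤ : ℕ∞) : WithTop ℕ∞) φ) (hφs : HasCompactSupport φ) :
    ∫ x, χ x * bracket (gradient W x) (gradient φ x) =
      -∫ x, W x * bracket (gradient χ x) (gradient φ x) := by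
  have hs : ∀ i, ContDiff ℝ ((⊤ : ℕ∞) : WithTop ℕ∞) (fun x => χ x * gradient φ x i) :=
    fun i => hχ.mul (contDiff_gradient_apply hφ i)
  have hc : ∀ i, HasCompactSupport (fun x => χ x * gradient φ x i) :=
    fun i => (hasCompactSupport_gradient_apply hφs i).mul_left
  have hI : ∀ i j, Integrable (fun x => W x * gradient (fun y => χ y * gradient φ y i) x j) :=
    fun i j => (hW.continuous.mul (contDiff_gradient_apply (hs i) j).continuous
      ).integrable_of_hasCompactSupport (hasCompactSupport_gradient_apply (hc i) j).mul_left
  calc ∫ x, χ x * bracket (gradient W x) (gradient φ x)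
      = ∫ x, (gradient W x 1 * (χ x * gradient φ x 0) -
          gradient W x 0 * (χ x * gradient φ x 1)) := by
        congr 1; funext x; rw [bracket]; ring
    _ = -∫ x, (W x * gradient (fun y => χ y * gradient φ y 0) x 1 -
          W x * gradient (fun y => χ y * gradient φ y 1) x 0) := by
        rw [integral_sub (integrable_gradient_mul hW (hs 0).continuous (hc 0) 1)
          (integrable_gradient_mul hW (hs 1).continuous (hc 1) 0),
          integral_gradient_mul hW (hs 0) (hc 0), integral_gradient_mul hW (hs 1) (hc 1),
          integral_sub (hI 0 1) (hI 1 0)]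
        ring
    _ = _ := by
        congr 2; funext x
        have d1 : DifferentiableAt ℝ χ x := hχ.differentiable (by simp) x
        have d2 : ∀ i, DifferentiableAt ℝ (fun y => gradient φ y i) x :=
          fun i => (contDiff_gradient_apply hφ i).differentiable (by simp) x
        rw [gradient_mul_apply d1 (d2 0), gradient_mul_apply d1 (d2 1),
          gradient_gradient_comm hφ 0 1, bracket]
        ring

/-- A closed property that holds for test functions holds on `H¹₀(Ω)`. -/
lemma H10.induction_of_isClosed {p : H10 Ω → Prop} (hcl : IsClosed {ψ | p ψ})
    (htest : ∀ ψ : H10 Ω, (ψ : WithLp 2 (L2 Ω × L2Vec Ω)) ∈ testGraph Ω → p ψ) (ψ : H10 Ω) :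
    p ψ := by
  obtain ⟨x, hx, hlim⟩ := mem_closure_iff_seq_limit.1
    (show (ψ : WithLp 2 (L2 Ω × L2Vec Ω)) ∈ closure (testGraph Ω : Set _) from ψ.2)
  have h1 : Tendsto (fun n => (⟨x n, subset_closure (hx n)⟩ : H10 Ω)) atTop (𝓝 ψ) :=
    tendsto_subtype_rng.2 hlim
  exact hcl.mem_of_tendsto h1 (.of_forall fun n => htest _ (hx n))

/-- The underlying `L²` function, as a bounded linear map. -/
def h10ToL2CLM (Ω : Set Plane) : H10 Ω →L[ℝ] L2 Ω :=
  (WithLp.fstL 2 ℝ (L2 Ω) (L2Vec Ω)).comp (H10 Ω).subtypeL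

lemma h10ToL2CLM_apply (ψ : H10 Ω) : h10ToL2CLM Ω ψ = h10ToL2 ψ := rfl

lemma memLp_bracket_gradient [IsFiniteMeasure (volume.restrict Ω)] {C : ℝ≥0} {W : Plane → ℝ}
    (hW : LipschitzWith C W) {φ : Plane → ℝ} (hφ : IsTestFunction Ω φ) :
    MemLp (fun x => bracket (gradient W x) (gradient φ x)) 2 (volume.restrict Ω) := by
  obtain ⟨D, hD⟩ := (hφ.1.of_le (by simp)).lipschitzWith_of_hasCompactSupport hφ.2.1
    (n := 1) (by simp)
  have hc : Measurable (fun z : Plane × Plane => bracket z.1 z.2) := by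
    unfold bracket; fun_prop
  refine MemLp.of_bound (hc.comp ((measurable_gradient W).prodMk
    (measurable_gradient φ))).aestronglyMeasurable (C * D) (.of_forall fun x => ?_)
  exact (abs_bracket_le _ _).trans (mul_le_mul (norm_gradient_le_of_lipschitz hW x)
    (norm_gradient_le_of_lipschitz hD x) (norm_nonneg _) C.2)

/-- The Poisson operator moves the derivatives from `ψ` to the vorticity:
`(𝒥(ω)ψ, φ) = -∫_Ω ψ {ω, φ}` for a test function `φ`. -/
theorem poissonOperator_apply_testFunction (hΩ : IsOpen Ω) [IsFiniteMeasure (volume.restrict Ω)]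
    {ω W : Plane → ℝ} (hω : MemLp ω ∞ (volume.restrict Ω)) {C : ℝ≥0} (hW : LipschitzWith C W)
    (hWω : ∀ x ∈ Ω, W x = ω x) {φ' : H10 Ω} {φ : Plane → ℝ} (hφ : IsTestFunction Ω φ)
    (hφ' : h10Grad φ' =ᵐ[volume.restrict Ω] gradient φ) (ψ : H10 Ω) :
    poissonOperator hω ψ φ' =
      -∫ x in Ω, h10ToL2 ψ x * bracket (gradient W x) (gradient φ x) := by
  have hb := memLp_bracket_gradient hW hφ
  have e : ∀ ψ : H10 Ω, ∫ x in Ω, h10ToL2 ψ x * bracket (gradient W x) (gradient φ x) =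
      inner ℝ (h10ToL2CLM Ω ψ) (hb.toLp _) := fun ψ => by
    rw [L2.inner_def]
    refine integral_congr_ae ?_
    filter_upwards [hb.coeFn_toLp] with x a
    rw [a, h10ToL2CLM_apply]
    simp [mul_comm]
  refine H10.induction_of_isClosed (p := fun ψ => poissonOperator hω ψ φ' =
      -∫ x in Ω, h10ToL2 ψ x * bracket (gradient W x) (gradient φ x)) ?_ ?_ ψ
  · simp_rw [e]
    refine isClosed_eq ?_ ?_
    · exact (ContinuousLinearMap.apply ℝ ℝ φ').continuous.comp (poissonOperator hω).continuous
    · exact ((h10ToL2CLM Ω).continuous.inner continuous_const).neg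
  · rintro ψ ⟨χ, hχ, h1, h2⟩
    rw [poissonOperator_apply]
    have hz : ∀ x ∉ Ω, gradient φ x = 0 := fun x hx =>
      gradient_eq_zero_of_notMem_tsupport fun hc => hx (hφ.2.2 hc)
    have e1 : ∫ x in Ω, ω x * bracket (h10Grad ψ x) (h10Grad φ' x) =
        ∫ x, W x * bracket (gradient χ x) (gradient φ x) := by
      refine Eq.trans (integral_congr_ae ?_) (setIntegral_eq_integral_of_forall_compl_eq_zero
        (s := Ω) (fun x hx => by simp [hz x hx, bracket]))
      filter_upwards [h2, hφ', ae_restrict_mem hΩ.measurableSet] with x a b c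
      rw [show h10Grad ψ x = gradient χ x from a, b, hWω x c]
    have e2 : ∫ x in Ω, h10ToL2 ψ x * bracket (gradient W x) (gradient φ x) =
        ∫ x, χ x * bracket (gradient W x) (gradient φ x) := by
      refine Eq.trans (integral_congr_ae ?_) (setIntegral_eq_integral_of_forall_compl_eq_zero
        (s := Ω) (fun x hx => by simp [hz x hx, bracket]))
      filter_upwards [h1] with x a
      rw [show h10ToL2 ψ x = χ x from a]
    rw [e1, e2, integral_mul_bracket_gradient hW hχ.1 hφ.1 hφ.2.1, neg_neg]

/-- The gradient of a Lipschitz function vanishes almost everywhere on each level set: there the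
positive and negative parts of `W - c` have minima. -/
theorem ae_fderiv_eq_zero_of_eq_const {C : ℝ≥0} {W : Plane → ℝ} (hW : LipschitzWith C W) (c : ℝ) :
    ∀ᵐ x, W x = c → HasFDerivAt W (0 : Plane →L[ℝ] ℝ) x := by
  have h1 : LipschitzWith C (fun x => max (W x) c) := hW.max_const c
  have h2 : LipschitzWith C (fun x => min (W x) c) := hW.min_const c
  filter_upwards [h1.ae_differentiableAt, h2.ae_differentiableAt] with x a b hx
  have e1 : fderiv ℝ (fun x => max (W x) c) x = 0 :=
    IsLocalMin.fderiv_eq_zero (.of_forall fun y => by simp [hx])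
  have e2 : fderiv ℝ (fun x => min (W x) c) x = 0 :=
    IsLocalMax.fderiv_eq_zero (.of_forall fun y => by simp [hx])
  have a' := a.hasFDerivAt
  have b' := b.hasFDerivAt
  rw [e1] at a'
  rw [e2] at b'
  have := (a'.add b').sub_const c
  rw [add_zero] at this
  refine this.congr_of_eventuallyEq (.of_forall fun y => ?_)
  have := max_add_min (W y) c
  simp only [Pi.add_apply]
  linarith

/-- The chain rule for selections: if `ψ` is a selection of `g ∘ W` then
`∇(G ∘ W) = ψ ∇W` almost everywhere. At the jumps both sides vanish. -/
theorem ae_gradient_comp_eq_smul {C : ℝ≥0} {W : Plane → ℝ} (hW : LipschitzWith C W)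
    (hc : Continuous gL) {G : ℝ → ℝ} (hGl : LocallyLipschitz G) {c : ℝ}
    (hG : ∀ ξ, G ξ = c + jumpPrimitive gL α h ξ) :
    ∀ᵐ x, ∀ y ∈ jumpFunction gL α h (W x), gradient (fun z => G (W z)) x = y • gradient W x := by
  filter_upwards [hW.ae_differentiableAt,
    ae_all_iff.2 fun l => ae_fderiv_eq_zero_of_eq_const hW (h l)] with x hd hl y hy
  suffices HasFDerivAt (fun z => G (W z)) (y • fderiv ℝ W x) x by
    rw [gradient, this.fderiv, map_smul]
    simp [gradient]
  by_cases hx : ∀ l, W x ≠ h l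
  · rw [jumpFunction_eq_singleton hx, mem_singleton_iff] at hy
    rw [hy]
    have h1 : HasDerivAt G (jumpLeft gL α h (W x)) (W x) := by
      rw [funext hG]
      exact (hasDerivAt_jumpPrimitive hc hx).const_add c
    exact h1.comp_hasFDerivAt x hd.hasFDerivAt
  · push Not at hx
    obtain ⟨l, hxl⟩ := hx
    have h0 := hl l hxl
    rw [h0.fderiv, smul_zero]
    obtain ⟨D, t, ht, hD⟩ := hGl (W x)
    rw [hasFDerivAt_iff_isLittleO] at h0 ⊢
    refine Asymptotics.IsBigO.trans_isLittleO (Asymptotics.IsBigO.of_bound D ?_) h0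
    filter_upwards [hW.continuous.continuousAt.eventually ht] with z hz
    simpa [Real.dist_eq] using hD.dist_le_mul _ hz _ (mem_of_mem_nhds ht)

/-- Singular Casimir elements are annihilated by the Poisson operator: if `ψ` is a selection of
`g ∘ ω`, then `ψ {ω, φ} = {G ∘ ω, φ}`, whose integral vanishes. -/
theorem mem_ker_poissonOperator (hΩ : IsOpen Ω) (hb : Bornology.IsBounded Ω)
    {ω : Plane → ℝ} {K : ℝ≥0} (hω : LipschitzOnWith K ω (closure Ω))
    (hω' : MemLp ω ∞ (volume.restrict Ω)) (hc : Continuous gL) {G : ℝ → ℝ}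
    (hGl : LocallyLipschitz G) {c : ℝ} (hG : ∀ ξ, G ξ = c + jumpPrimitive gL α h ξ) {ψ : H10 Ω}
    (hψ : ∀ᵐ x ∂(volume.restrict Ω), h10ToL2 ψ x ∈ jumpFunction gL α h (ω x)) :
    ψ ∈ (poissonOperator hω').ker := by
  have : IsFiniteMeasure (volume.restrict Ω) :=
    ⟨by rw [Measure.restrict_apply_univ]; exact hb.measure_lt_top⟩
  obtain ⟨W, hW, hWω⟩ := hω.extend_real
  have hcomp := hb.isCompact_closure.image_of_continuousOn hω.continuousOn
  obtain ⟨D, hD⟩ := (hGl.locallyLipschitzOn (s := ω '' closure Ω)).exists_lipschitzOnWith_of_compact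
    hcomp
  obtain ⟨F, hF, hFω⟩ := (hD.comp hω (mapsTo_image ω (closure Ω))).extend_real
  have hsub : Ω ⊆ closure Ω := subset_closure
  have key : ∀ φ' : H10 Ω, poissonOperator hω' ψ φ' = 0 := by
    refine H10.induction_of_isClosed (isClosed_eq (poissonOperator hω' ψ).continuous
      continuous_const) ?_
    rintro φ' ⟨φ, hφ, h1, h2⟩
    rw [poissonOperator_apply_testFunction hΩ hω' hW (fun x hx => (hWω (hsub hx)).symm) hφ h2,
      neg_eq_zero]
    have e : ∫ x in Ω, h10ToL2 ψ x * bracket (gradient W x) (gradient φ x) =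
        ∫ x, (fun _ => (1 : ℝ)) x * bracket (gradient F x) (gradient φ x) := by
      refine Eq.trans (integral_congr_ae ?_) (setIntegral_eq_integral_of_forall_compl_eq_zero
        (s := Ω) fun x hx => by
          simp [gradient_eq_zero_of_notMem_tsupport fun hc => hx (hφ.2.2 hc), bracket])
      filter_upwards [hψ, ae_restrict_of_ae (ae_gradient_comp_eq_smul (α := α) (h := h) hW hc hGl
        hG), ae_restrict_mem hΩ.measurableSet] with x a b hx
      have hFW : F =ᶠ[𝓝 x] fun z => G (W z) := by
        filter_upwards [hΩ.mem_nhds hx] with z hz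
        rw [← hFω (hsub hz), ← hWω (hsub hz)]; rfl
      have hgr : gradient F x = gradient (fun z => G (W z)) x := by
        rw [gradient, gradient, hFW.fderiv_eq]
      rw [hWω (hsub hx)] at a
      rw [hgr, b _ a]
      simp only [bracket, PiLp.smul_apply, smul_eq_mul]
      ring
    rw [e, integral_mul_bracket_gradient (χ := fun _ => 1) hF contDiff_const hφ.1 hφ.2.1]
    have hz : gradient (fun _ : Plane => (1 : ℝ)) = fun _ => 0 := by
      ext1 x; simp [gradient]
    simp [hz, bracket]
  rw [LinearMap.mem_ker]
  exact ContinuousLinearMap.ext key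

/-! ### Lipschitz functions in `H¹₀` and selections of `g ∘ ω` -/

/-- Weak compactness of balls: the image of a bounded sequence in a Hilbert space can converge
only to a point of the range. -/
theorem exists_eq_of_tendsto_of_norm_le {H Y : Type*} [NormedAddCommGroup H]
    [InnerProductSpace ℝ H] [CompleteSpace H] [NormedAddCommGroup Y] [InnerProductSpace ℝ Y]
    [CompleteSpace Y] (T : H →L[ℝ] Y) {x : ℕ → H} {M : ℝ} (hx : ∀ n, ‖x n‖ ≤ M) {y : Y}
    (hy : Tendsto (fun n => T (x n)) atTop (𝓝 y)) : ∃ z, T z = y := by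
  set f : ℕ → WeakDual ℝ H := fun n => StrongDual.toWeakDual (InnerProductSpace.toDual ℝ H (x n))
  have hf : ((hyperfilter ℕ).map f : Filter (WeakDual ℝ H)) ≤
      𝓟 (WeakDual.toStrongDual ⁻¹' Metric.closedBall (0 : StrongDual ℝ H) M) := by
    rw [le_principal_iff]
    refine mem_map.2 (univ_mem' fun n => ?_)
    have : ‖InnerProductSpace.toDual ℝ H (x n)‖ ≤ M := by
      rw [LinearIsometryEquiv.norm_map]; exact hx n
    exact mem_closedBall_zero_iff.2 this
  obtain ⟨ℓ, -, hℓ⟩ := (WeakDual.isCompact_closedBall (0 : StrongDual ℝ H) M).ultrafilter_le_nhds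
    ((hyperfilter ℕ).map f) hf
  have hev : ∀ v : H, Tendsto (fun n => inner ℝ (x n) v) (hyperfilter ℕ : Filter ℕ)
      (𝓝 (ℓ v)) := fun v =>
    ((WeakDual.eval_continuous v).tendsto ℓ).comp (show Tendsto f (hyperfilter ℕ) (𝓝 ℓ) from hℓ)
  refine ⟨(InnerProductSpace.toDual ℝ H).symm (WeakDual.toStrongDual ℓ),
    ext_inner_right ℝ fun v => ?_⟩
  rw [← ContinuousLinearMap.adjoint_inner_right, InnerProductSpace.toDual_symm_apply]
  refine tendsto_nhds_unique (hev (ContinuousLinearMap.adjoint T v)) ?_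
  simp_rw [ContinuousLinearMap.adjoint_inner_right]
  exact (hy.mono_left Nat.hyperfilter_le_atTop).inner tendsto_const_nhds

open scoped Convolution in
/-- A Lipschitz function that vanishes off `Ω` is uniformly approximated by test functions with the
same Lipschitz constant: truncate the values near `0`, then mollify. -/
theorem exists_testFunction_approx (hΩ : IsOpen Ω) (hb : Bornology.IsBounded Ω) {C : ℝ≥0}
    {f : Plane → ℝ} (hf : LipschitzWith C f) (hf0 : ∀ x ∉ Ω, f x = 0) {ε : ℝ} (hε : 0 < ε) :
    ∃ φ, IsTestFunction Ω φ ∧ LipschitzWith C φ ∧ ∀ x, |φ x - f x| ≤ 2 * ε := by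
  set F : Plane → ℝ := fun x => max (f x - ε) (min (f x + ε) 0) with hF
  have hFL : LipschitzWith C F := by
    have h1 : LipschitzWith C (fun x => f x - ε) :=
      LipschitzWith.of_dist_le_mul fun x y => by simpa using hf.dist_le_mul x y
    have h2 : LipschitzWith C (fun x => f x + ε) :=
      LipschitzWith.of_dist_le_mul fun x y => by simpa using hf.dist_le_mul x y
    simpa using h1.max (h2.min_const 0)
  have hFf : ∀ x, |F x - f x| ≤ ε := fun x => by
    simp only [hF]
    rcases max_cases (f x - ε) (min (f x + ε) 0) with ⟨e, e'⟩ | ⟨e, e'⟩ <;>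
      rcases min_cases (f x + ε) 0 with ⟨d, d'⟩ | ⟨d, d'⟩ <;>
      rw [e] <;> rw [abs_le] <;> constructor <;> linarith
  set S : Set Plane := {x | ε ≤ |f x|}
  have hSc : IsClosed S := isClosed_le continuous_const hf.continuous.abs
  have hSΩ : S ⊆ Ω := fun x hx => by
    by_contra hc
    have : ε ≤ |f x| := hx
    rw [hf0 x hc, abs_zero] at this
    linarith
  have hScpt : IsCompact S := Metric.isCompact_of_isClosed_isBounded hSc (hb.subset hSΩ)
  have hFS : Function.support F ⊆ S := fun x hx => by
    by_contra hc
    have h1 : |f x| < ε := not_le.1 hc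
    have h2 := abs_lt.1 h1
    refine hx ?_
    simp only [hF]
    rw [min_eq_right (by linarith), max_eq_right (by linarith)]
  obtain ⟨r, hr, hrΩ⟩ := hScpt.exists_cthickening_subset_open hΩ hSΩ
  have hC1 : (0 : ℝ) < C + 1 := by positivity
  set R : ℝ := min r (ε / (C + 1))
  have hR : 0 < R := lt_min hr (div_pos hε hC1)
  let b : ContDiffBump (0 : Plane) := ⟨R / 2, R, half_pos hR, half_lt_self hR⟩
  set φ : Plane → ℝ := (b.normed volume ⋆[ContinuousLinearMap.lsmul ℝ ℝ, volume] F : Plane → ℝ)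
  have hloc : LocallyIntegrable F volume := hFL.continuous.locallyIntegrable
  have hex : ∀ x, Integrable (fun t => b.normed volume t * F (x - t)) := fun x =>
    b.hasCompactSupport_normed.convolutionExists_left
      (L := ContinuousLinearMap.lsmul ℝ ℝ) b.continuous_normed hloc x
  refine ⟨φ, ⟨?_, ?_, ?_⟩, LipschitzWith.of_dist_le_mul fun x y => ?_, fun x => ?_⟩
  · exact b.hasCompactSupport_normed.contDiff_convolution_left
      (ContinuousLinearMap.lsmul ℝ ℝ) b.contDiff_normed hloc
  · exact b.hasCompactSupport_normed.convolution (ContinuousLinearMap.lsmul ℝ ℝ)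
      (hScpt.of_isClosed_subset isClosed_closure (closure_minimal hFS hSc))
  · refine (closure_minimal ?_ Metric.isClosed_cthickening).trans hrΩ
    refine (support_convolution_subset (ContinuousLinearMap.lsmul ℝ ℝ)).trans ?_
    rw [b.support_normed_eq]
    rintro _ ⟨u, hu, v, hv, rfl⟩
    refine Metric.mem_cthickening_of_dist_le _ v r S (hFS hv) ?_
    rw [dist_eq_norm]
    have : ‖u‖ < R := by simpa using hu
    simpa using this.le.trans (min_le_left _ _)
  · have e : φ x - φ y = ∫ t, b.normed volume t * (F (x - t) - F (y - t)) := by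
      simp_rw [mul_sub]
      rw [integral_sub (hex x) (hex y)]
      rfl
    rw [Real.dist_eq, e, ← Real.norm_eq_abs]
    have hbi : Integrable (fun t => b.normed volume t * (C * dist x y)) :=
      b.integrable_normed.mul_const _
    refine (norm_integral_le_of_norm_le hbi (.of_forall fun t => ?_)).trans (le_of_eq ?_)
    · rw [norm_mul, Real.norm_eq_abs, abs_of_nonneg (b.nonneg_normed t)]
      refine mul_le_mul_of_nonneg_left ?_ (b.nonneg_normed t)
      rw [← dist_eq_norm]
      simpa using hFL.dist_le_mul (x - t) (y - t)
    · rw [integral_mul_const, b.integral_normed, one_mul]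
  · have h1 : dist (φ x) (F x) ≤ ε := by
      refine b.dist_normed_convolution_le hFL.continuous.aestronglyMeasurable fun y hy => ?_
      refine (hFL.dist_le_mul y x).trans ?_
      have h2 : dist y x ≤ ε / (C + 1) := (Metric.mem_ball.1 hy).le.trans (min_le_right _ _)
      calc (C : ℝ) * dist y x ≤ (C + 1) * (ε / (C + 1)) :=
            mul_le_mul (by linarith) h2 dist_nonneg hC1.le
        _ = ε := mul_div_cancel₀ _ hC1.ne'
    have h3 := abs_add_le (φ x - F x) (F x - f x)
    rw [sub_add_sub_cancel] at h3
    rw [Real.dist_eq] at h1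
    linarith [hFf x]

/-- A Lipschitz function that vanishes off `Ω` belongs to `H¹₀(Ω)`: the approximating test
functions are bounded in `H¹`. -/
theorem exists_h10_of_lipschitz (hΩ : IsOpen Ω) (hb : Bornology.IsBounded Ω) {C : ℝ≥0}
    {f : Plane → ℝ} (hf : LipschitzWith C f) (hf0 : ∀ x ∉ Ω, f x = 0) :
    ∃ ψ : H10 Ω, h10ToL2 ψ =ᵐ[volume.restrict Ω] f := by
  have : IsFiniteMeasure (volume.restrict Ω) :=
    ⟨by rw [Measure.restrict_apply_univ]; exact hb.measure_lt_top⟩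
  have hlip : ∀ {D : ℝ≥0} {g : Plane → ℝ}, LipschitzWith D g → MemLp g 2 (volume.restrict Ω) :=
    fun hg => memLp_of_lipschitzOn_closure hΩ hb hg.lipschitzOnWith 2
  choose φ hφ hφC hφf using fun n : ℕ =>
    exists_testFunction_approx hΩ hb hf hf0 (Nat.one_div_pos_of_nat (α := ℝ) (n := n))
  have hgr : ∀ n, MemLp (gradient (φ n)) 2 (volume.restrict Ω) := fun n =>
    MemLp.of_bound (measurable_gradient _).aestronglyMeasurable C
      (.of_forall fun x => norm_gradient_le_of_lipschitz (hφC n) x)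
  set V : ℝ := (measureUnivNNReal (volume.restrict Ω) : ℝ) ^ (2 : ℝ≥0∞).toReal⁻¹
  have hV : 0 ≤ V := by positivity
  let y : L2 Ω := (hlip hf).toLp f
  let p : ℕ → L2 Ω := fun n => (hlip (hφC n)).toLp (φ n)
  let q : ℕ → L2Vec Ω := fun n => (hgr n).toLp (gradient (φ n))
  have hp : ∀ n, ‖p n - y‖ ≤ V * (2 * (1 / ((n : ℝ) + 1))) := fun n => by
    refine Lp.norm_le_of_ae_bound (by positivity) ?_
    filter_upwards [Lp.coeFn_sub (p n) y, (hlip (hφC n)).coeFn_toLp, (hlip hf).coeFn_toLp]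
      with x a b c
    rw [a, Pi.sub_apply, b, c]
    exact hφf n x
  have hq : ∀ n, ‖q n‖ ≤ V * C := fun n => by
    refine Lp.norm_le_of_ae_bound C.2 ?_
    filter_upwards [(hgr n).coeFn_toLp] with x a
    rw [a]
    exact norm_gradient_le_of_lipschitz (hφC n) x
  let z : ℕ → H10 Ω := fun n => ⟨WithLp.toLp 2 (p n, q n), subset_closure
    ⟨φ n, hφ n, (hlip (hφC n)).coeFn_toLp, (hgr n).coeFn_toLp⟩⟩
  have hz : ∀ n, ‖z n‖ ≤ (‖y‖ + V * 2) + V * C := fun n => by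
    have h1 : ‖p n‖ ≤ ‖y‖ + V * 2 := by
      have h2 := norm_le_norm_add_norm_sub' (p n) y
      have h3 : 1 / ((n : ℝ) + 1) ≤ 1 := by
        rw [div_le_one (by positivity)]; linarith [n.cast_nonneg (α := ℝ)]
      have h4 := mul_le_mul_of_nonneg_left h3 hV
      linarith [hp n]
    have h5 : ‖z n‖ = √(‖p n‖ ^ 2 + ‖q n‖ ^ 2) := WithLp.prod_norm_eq_of_L2 _
    rw [h5]
    refine Real.sqrt_le_iff.2 ⟨by positivity, ?_⟩
    have h6 := hq n
    nlinarith [norm_nonneg (p n), norm_nonneg (q n)]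
  have hlim : Tendsto (fun n => h10ToL2CLM Ω (z n)) atTop (𝓝 y) := by
    rw [tendsto_iff_norm_sub_tendsto_zero]
    refine squeeze_zero (fun _ => norm_nonneg _) hp ?_
    simpa using (tendsto_one_div_add_atTop_nhds_zero_nat (𝕜 := ℝ)).const_mul 2 |>.const_mul V
  obtain ⟨ψ, hψ⟩ := exists_eq_of_tendsto_of_norm_le (h10ToL2CLM Ω) hz hlim
  refine ⟨ψ, ?_⟩
  rw [← h10ToL2CLM_apply, hψ]
  exact (hlip hf).coeFn_toLp

/-- Extension by zero preserves the Lipschitz constant of a function that vanishes on the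
boundary: a segment from inside to outside meets the boundary. -/
theorem lipschitzWith_indicator_of_frontier {C : ℝ≥0} {f : Plane → ℝ} (hΩ : IsOpen Ω)
    (hf : LipschitzWith C f) (hf0 : ∀ x ∈ frontier Ω, f x = 0) :
    LipschitzWith C (Ω.indicator f) := by
  have key : ∀ x ∈ Ω, ∀ y ∉ Ω, |f x| ≤ C * dist x y := by
    intro x hx y hy
    obtain ⟨z, hz, hzf⟩ : ∃ z ∈ segment ℝ x y, z ∈ frontier Ω := by
      by_contra! hc
      have hsub : segment ℝ x y ⊆ Ω ∪ (closure Ω)ᶜ := fun z hz => by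
        by_contra hn
        rw [mem_union, not_or, mem_compl_iff, not_not] at hn
        exact hc z hz (hΩ.frontier_eq ▸ ⟨hn.2, hn.1⟩)
      obtain ⟨z, -, h1, h2⟩ := (convex_segment x y).isPreconnected _ _ hΩ
        isClosed_closure.isOpen_compl hsub ⟨x, left_mem_segment ℝ x y, hx⟩
        ⟨y, right_mem_segment ℝ x y, (hsub (right_mem_segment ℝ x y)).resolve_left hy⟩
      exact h2 (subset_closure h1)
    have h1 := hf.dist_le_mul x z
    rw [hf0 z hzf, Real.dist_eq, sub_zero] at h1
    refine h1.trans (mul_le_mul_of_nonneg_left ?_ C.2)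
    rw [← dist_add_dist_of_mem_segment hz]
    linarith [dist_nonneg (x := z) (y := y)]
  refine LipschitzWith.of_dist_le_mul fun x y => ?_
  by_cases hx : x ∈ Ω <;> by_cases hy : y ∈ Ω
  · rw [indicator_of_mem hx, indicator_of_mem hy]
    exact hf.dist_le_mul x y
  · rw [indicator_of_mem hx, indicator_of_notMem hy, Real.dist_eq, sub_zero]
    exact key x hx y hy
  · rw [indicator_of_notMem hx, indicator_of_mem hy, dist_comm, Real.dist_eq, sub_zero, dist_comm]
    exact key y hy x hx
  · rw [indicator_of_notMem hx, indicator_of_notMem hy, dist_self]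
    positivity

/-- A Lipschitz function with values in `[0, 1]` that is `0`, `1` and `s` on three disjoint
compact sets. -/
lemma exists_lipschitz_interpolation {A B D : Set Plane} (hA : IsCompact A) (hB : IsCompact B)
    (hD : IsCompact D) (hAB : Disjoint A B) (hAD : Disjoint A D) (hBD : Disjoint B D) {s : ℝ}
    (hs : s ∈ Icc (0 : ℝ) 1) :
    ∃ (χ : Plane → ℝ) (C : ℝ≥0), LipschitzWith C χ ∧ (∀ x, χ x ∈ Icc (0 : ℝ) 1) ∧
      (∀ x ∈ A, χ x = 0) ∧ (∀ x ∈ B, χ x = 1) ∧ ∀ x ∈ D, χ x = s := by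
  classical
  set q : Plane → ℝ := fun x => if x ∈ B then 1 else if x ∈ D then s else 0
  have hqA : ∀ x ∈ A, q x = 0 := fun x hx => by
    simp [q, disjoint_left.1 hAB hx, disjoint_left.1 hAD hx]
  have hqB : ∀ x ∈ B, q x = 1 := fun x hx => by simp [q, hx]
  have hqD : ∀ x ∈ D, q x = s := fun x hx => by simp [q, hx, disjoint_right.1 hBD hx]
  -- Locally constant on the union: near a point of one set the other two are absent.
  have hloc : LocallyLipschitzOn (A ∪ B ∪ D) q := by
    intro x hx
    have hconst : ∀ (U : Set Plane) (c : ℝ), IsClosed U → x ∉ U →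
        (∀ y ∈ A ∪ B ∪ D, y ∉ U → q y = c) →
        ∃ K : ℝ≥0, ∃ t ∈ 𝓝[A ∪ B ∪ D] x, LipschitzOnWith K q t := fun U c hU hxU hc => by
      refine ⟨0, Uᶜ ∩ (A ∪ B ∪ D), inter_mem
        (mem_nhdsWithin_of_mem_nhds (hU.isOpen_compl.mem_nhds hxU)) self_mem_nhdsWithin, ?_⟩
      refine LipschitzOnWith.of_dist_le_mul fun y hy z hz => ?_
      rw [hc y hy.2 hy.1, hc z hz.2 hz.1, dist_self]
      simp
    rcases hx with (hx | hx) | hx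
    · refine hconst (B ∪ D) 0 (hB.isClosed.union hD.isClosed) ?_ ?_
      · exact fun hn => hn.elim (disjoint_left.1 hAB hx) (disjoint_left.1 hAD hx)
      · rintro y ((hy | hy) | hy) hn
        exacts [hqA y hy, absurd (Or.inl hy) hn, absurd (Or.inr hy) hn]
    · refine hconst (A ∪ D) 1 (hA.isClosed.union hD.isClosed) ?_ ?_
      · exact fun hn => hn.elim (disjoint_right.1 hAB hx) (disjoint_left.1 hBD hx)
      · rintro y ((hy | hy) | hy) hn
        exacts [absurd (Or.inl hy) hn, hqB y hy, absurd (Or.inr hy) hn]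
    · refine hconst (A ∪ B) s (hA.isClosed.union hB.isClosed) ?_ ?_
      · exact fun hn => hn.elim (disjoint_right.1 hAD hx) (disjoint_right.1 hBD hx)
      · rintro y ((hy | hy) | hy) hn
        exacts [absurd (Or.inl hy) hn, absurd (Or.inr hy) hn, hqD y hy]
  obtain ⟨C, hC⟩ := hloc.exists_lipschitzOnWith_of_compact ((hA.union hB).union hD)
  obtain ⟨F, hF, hFq⟩ := hC.extend_real
  refine ⟨fun x => max (min (F x) 1) 0, C, (hF.min_const 1).max_const 0,
    fun x => ⟨le_max_right _ _, max_le (min_le_right _ _) zero_le_one⟩, fun x hx => ?_,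
    fun x hx => ?_, fun x hx => ?_⟩
  · simp [← hFq (Or.inl (Or.inl hx)), hqA x hx]
  · simp [← hFq (Or.inl (Or.inr hx)), hqB x hx]
  · simp [← hFq (Or.inr hx), hqD x hx, hs.1, hs.2]

lemma exists_lipschitzWith_sum {ι : Type*} (s : Finset ι) {f : ι → Plane → ℝ}
    (hf : ∀ i, ∃ C : ℝ≥0, LipschitzWith C (f i)) :
    ∃ C : ℝ≥0, LipschitzWith C (fun x => ∑ i ∈ s, f i x) := by
  classical
  induction s using Finset.induction_on with
  | empty => exact ⟨0, by simp⟩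
  | insert i s hi ih =>
    obtain ⟨C, hC⟩ := ih
    obtain ⟨D, hD⟩ := hf i
    exact ⟨D + C, by simpa [Finset.sum_insert hi] using hD.add hC⟩

/-- When the jumps occur only at heights whose level sets separate the regions below and above,
`g ∘ ω` has a selection in `H¹₀(Ω)`: interpolate each step by a Lipschitz function across the level
set, with boundary values adjusted so that the selection vanishes on the boundary. -/
theorem exists_h10_selection (hΩ : IsOpen Ω) (hb : Bornology.IsBounded Ω) {ω : Plane → ℝ}
    {K : ℝ≥0} (hω : LipschitzOnWith K ω (closure Ω)) {L : ℝ≥0} (hgL : LipschitzWith L gL)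
    (hbd : ∀ x ∈ frontier Ω, (0 : ℝ) ∈ jumpFunction gL α h (ω x))
    (hsep : ∀ l, α l ≠ 0 → IsSeparatingHeight Ω ω (h l)) :
    ∃ ψ : H10 Ω, ∀ᵐ x ∂(volume.restrict Ω), h10ToL2 ψ x ∈ jumpFunction gL α h (ω x) := by
  obtain ⟨W, hW, hWω⟩ := hω.extend_real
  have hsub : Ω ⊆ closure Ω := subset_closure
  -- A choice of step values at each height, balancing to `0` wherever that is possible.
  have hS : ∀ c : ℝ, ∃ s : Fin ν → ℝ, (∀ l, s l ∈ filledStep (c - h l)) ∧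
      ((0 : ℝ) ∈ jumpFunction gL α h c → gL c + ∑ l, α l * s l = 0) := fun c => by
    by_cases hc : (0 : ℝ) ∈ jumpFunction gL α h c
    · obtain ⟨s, hs, e⟩ := hc
      exact ⟨s, hs, fun _ => e.symm⟩
    · obtain ⟨s, hs, -⟩ := jumpLeft_mem gL α h c
      exact ⟨s, hs, fun a => absurd a hc⟩
  choose S hSm hS0 using hS
  have hχ : ∀ l, ∃ (χ : Plane → ℝ) (C : ℝ≥0), LipschitzWith C χ ∧ (α l ≠ 0 →
      (∀ x, χ x ∈ Icc (0 : ℝ) 1) ∧ (∀ x ∈ closure {x ∈ Ω | ω x < h l}, χ x = 0) ∧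
      (∀ x ∈ closure {x ∈ Ω | h l < ω x}, χ x = 1) ∧
      ∀ x ∈ frontier Ω ∩ {x | W x = h l}, χ x = S (h l) l) := fun l => by
    by_cases hl : α l = 0
    · exact ⟨fun _ => 0, 0, LipschitzWith.const 0, fun hn => absurd hl hn⟩
    · obtain ⟨h1, h2⟩ := hsep l hl
      have hcpt : ∀ {U : Set Plane}, U ⊆ Ω → IsCompact (closure U) :=
        fun hU => (hb.subset hU).isCompact_closure
      have hfr : IsCompact (frontier Ω) :=
        hb.isCompact_closure.of_isClosed_subset isClosed_frontier frontier_subset_closure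
      have hD : IsCompact (frontier Ω ∩ {x | W x = h l}) :=
        hfr.inter_right (isClosed_eq hW.continuous continuous_const)
      have hdisj : ∀ p : ℝ → Prop, ¬ p (h l) →
          Disjoint (closure {x ∈ Ω | p (ω x)}) (frontier Ω ∩ {x | W x = h l}) := by
        refine fun p hp => disjoint_left.2 fun x hx hxD => ?_
        have hxω : ω x = h l := by
          rw [hWω (frontier_subset_closure hxD.1)]; exact hxD.2
        have h3 := eventually_nhdsWithin_iff.1 (h2 x hxD.1 hxω)
        obtain ⟨y, hy, hy'⟩ := ((mem_closure_iff_frequently.1 hx).and_eventually h3).exists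
        exact hp (hy' hy.1 ▸ hy.2)
      have hs := (hSm (h l) l).2.1 (sub_self _)
      obtain ⟨χ, C, hC, hχ⟩ := exists_lipschitz_interpolation
        (hcpt fun x hx => hx.1) (hcpt fun x hx => hx.1) hD h1
        (hdisj (fun r => r < h l) (lt_irrefl _)) (hdisj (fun r => h l < r) (lt_irrefl _)) hs
      exact ⟨χ, C, hC, fun _ => hχ⟩
  choose χ C hC hχ using hχ
  obtain ⟨D, hD⟩ := exists_lipschitzWith_sum Finset.univ (f := fun l x => α l * χ l x)
    fun l => ⟨_, (lipschitzWith_smul (α l)).comp (hC l)⟩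
  set f : Plane → ℝ := fun x => gL (W x) + ∑ l, α l * χ l x
  have hf : LipschitzWith (L * K + D) f := (hgL.comp hW).add hD
  have hf0 : ∀ x ∈ frontier Ω, f x = 0 := by
    intro x hx
    have hxc := frontier_subset_closure hx
    rw [← hS0 (ω x) (hbd x hx)]
    simp only [f]
    rw [← hWω hxc]
    congr 1
    refine Finset.sum_congr rfl fun l _ => ?_
    by_cases hl : α l = 0
    · simp [hl]
    congr 1
    obtain ⟨-, hA, hB, hE⟩ := hχ l hl
    have hmem : ∀ U : Set ℝ, IsOpen U → ω x ∈ U → x ∈ closure {y ∈ Ω | ω y ∈ U} := by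
      intro U hU hxU
      rw [hWω hxc] at hxU
      refine mem_closure_iff_frequently.2 ?_
      refine ((mem_closure_iff_frequently.1 hxc).and_eventually
        (hW.continuous.continuousAt.eventually (hU.mem_nhds hxU))).mono fun y hy => ⟨hy.1, ?_⟩
      rw [hWω (hsub hy.1)]; exact hy.2
    rcases lt_trichotomy (ω x) (h l) with hlt | heq | hgt
    · rw [hA x (hmem (Iio (h l)) isOpen_Iio hlt), (hSm (ω x) l).1 (by linarith)]
    · rw [hE x ⟨hx, (hWω hxc).symm.trans heq⟩, heq]
    · rw [hB x (hmem (Ioi (h l)) isOpen_Ioi hgt), (hSm (ω x) l).2.2 (by linarith)]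
  obtain ⟨ψ, hψ⟩ := exists_h10_of_lipschitz hΩ hb (lipschitzWith_indicator_of_frontier hΩ hf hf0)
    fun x hx => indicator_of_notMem hx f
  refine ⟨ψ, ?_⟩
  filter_upwards [hψ, ae_restrict_mem hΩ.measurableSet] with x a hx
  rw [a, indicator_of_mem hx]
  refine ⟨fun l => if α l = 0 then S (ω x) l else χ l x, fun l => ?_, ?_⟩
  · dsimp only
    split_ifs with hl
    · exact hSm _ _
    · obtain ⟨hI, hA, hB, -⟩ := hχ l hl
      exact ⟨fun hn => hA x (subset_closure ⟨hx, by linarith⟩), fun _ => hI x,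
        fun hn => hB x (subset_closure ⟨hx, by linarith⟩)⟩
  · simp only [f]
    rw [← hWω (hsub hx)]
    congr 1
    refine Finset.sum_congr rfl fun l _ => ?_
    split_ifs with hl <;> simp [hl]

end

theorem corollary1
    (Ω : Set Plane) (hΩ : IsOpen Ω) (hb : Bornology.IsBounded Ω)
    (ω : Plane → ℝ) (K : ℝ≥0) (hω : LipschitzOnWith K ω (closure Ω))
    (gL : ℝ → ℝ) (L : ℝ≥0) (hgL : LipschitzWith L gL)
    (ν : ℕ) (α h : Fin ν → ℝ) (hh : ∀ l, IsPlateauHeight Ω ω (h l))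
    (g : ℝ → Set ℝ) (hg : ∀ ξ, g ξ = jumpFunction gL α h ξ)
    (hbd : ∀ x ∈ frontier Ω, (0 : ℝ) ∈ g (ω x))
    (G : ℝ → ℝ) (hG : LocallyLipschitz G) (hgG : ∀ ξ, g ξ = clarkeGradientReal G ξ) :
    let ω₂ : L2 Ω := (memLp_of_lipschitzOn_closure hΩ hb hω 2).toLp ω
    let J : H10 Ω →L[ℝ] HMinus1 Ω :=
      poissonOperator (memLp_of_lipschitzOn_closure hΩ hb hω ∞)
    (∀ u : L2 Ω, Integrable (fun x => G (u x)) (volume.restrict Ω)) ∧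
    LocallyLipschitz (casimir Ω G) ∧
    (clarkeGradient (casimir Ω G) ω₂).Nonempty ∧
    clarkeGradient (casimir Ω G) ω₂ =
      {ψ : L2 Ω | ∀ᵐ x ∂(volume.restrict Ω), ψ x ∈ g (ω x)} ∧
    (∀ ψ : H10 Ω, h10ToL2 ψ ∈ clarkeGradient (casimir Ω G) ω₂ → ψ ∈ J.ker) ∧
    ((∀ l, α l ≠ 0 → IsSeparatingHeight Ω ω (h l)) →
      ∃ ψ : H10 Ω, h10ToL2 ψ ∈ clarkeGradient (casimir Ω G) ω₂ ∧ ψ ∈ J.ker) := by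
  intro ω₂ J
  have hfin : IsFiniteMeasure (volume.restrict Ω) :=
    ⟨by rw [Measure.restrict_apply_univ]; exact hb.measure_lt_top⟩
  obtain rfl : g = jumpFunction gL α h := funext hg
  have hc := hgL.continuous
  obtain ⟨c, hGc⟩ := exists_eq_const_add_jumpPrimitive hc hG hgG
  obtain ⟨C, hC0, hC⟩ := exists_abs_jumpPrimitive_sub_le (α := α) (h := h) hgL
  have hgrowth : ∀ a b, |G b - G a| ≤ C * (1 + |a| + |b|) * |b - a| := fun a b => by
    rw [hGc, hGc, add_sub_add_left_eq_sub]; exact hC a b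
  have hint : ∀ u : L2 Ω, Integrable (fun x => G (u x)) (volume.restrict Ω) :=
    integrable_comp_of_growth hG.continuous hgrowth
  have hω₂ : ω₂ =ᵐ[volume.restrict Ω] ω := MemLp.coeFn_toLp _
  have hmem : ∀ ψ : L2 Ω, ψ ∈ clarkeGradient (casimir Ω G) ω₂ ↔
      ∀ᵐ x ∂(volume.restrict Ω), ψ x ∈ jumpFunction gL α h (ω x) := by
    refine fun ψ => ⟨fun hψ => ?_, fun hψ => mem_clarkeGradient_of_ae_mem hgL hGc hint ?_⟩
    · have hconv : ∀ ξ, Convex ℝ (jumpFunction gL α h ξ) := fun ξ => by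
        rw [hgG]; exact convex_convexHull ℝ _
      filter_upwards [ae_mem_of_mem_clarkeGradient hgL hGc hint hconv hψ, hω₂] with x a b
      rwa [← b]
    · filter_upwards [hψ, hω₂] with x a b
      rw [b]
      exact clarkeGradientReal_subset_uIcc hc hGc _ (hgG _ ▸ a)
  have hker : ∀ ψ : H10 Ω, h10ToL2 ψ ∈ clarkeGradient (casimir Ω G) ω₂ → ψ ∈ J.ker :=
    fun ψ hψ => mem_ker_poissonOperator hΩ hb hω _ hc hG hGc ((hmem _).1 hψ)
  refine ⟨hint, locallyLipschitz_casimir hG.continuous hC0 hgrowth, ?_, Set.ext hmem, hker,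
    fun hsep => ?_⟩
  · have hγ := memLp_jumpLeft_comp (α := α) (h := h) hgL ω₂
    refine ⟨hγ.toLp _, (hmem _).2 ?_⟩
    filter_upwards [hγ.coeFn_toLp, hω₂] with x a b
    rw [a, b]
    exact jumpLeft_mem _ _ _ _
  · obtain ⟨ψ, hψ⟩ := exists_h10_selection hΩ hb hω hgL hbd hsep
    exact ⟨ψ, (hmem _).2 hψ, hker ψ ((hmem _).2 hψ)⟩
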